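/- Let $\mathcal C\subseteq\mathbb F_2^n$ be a binary linear code whose nonzero codewords have weight at least $2t+1$ and whose permutation automorphism group is transitive on positions (for instance any cyclic code, in particular a $t$-error-correcting BCH code). Let $\sigma>0$. A bit $c$ sent over the bi-AWGN channel is received as $y=(-1)^c+z$, $z\sim\mathcal N(0,\sigma^2)$ (independent uses); its LLR is $l=2y/\sigma^2$, and $\hat l\in\{\pm1\}$ is the sign of $l$. $\mathsf B$ maps a negative value to $1$ and any other value to $0$. **Decoder.** For $\boldsymbol y\in\mathbb F_2^n$, bounded distance decoding (BDD) outputs at position $j$ the value $(-1)^{\tilde c_j}$ if there is $\tilde{\boldsymbol c}\in\mathcal C$ with $\mathsf d_{\mathsf H}(\tilde{\boldsymbol c},\boldsymbol y)\le t$, and $0$ otherwise. In iBDD-CR with extrinsic BDD, the message of a constraint node (CN) on the bit at its position $j$ is $\mathsf B(\tilde\mu+l)$. Here $l$ is the channel LLR of that bit, $\bar\mu$ is the BDD output at $j$ for the incoming messages with the $j$-th one replaced by $\mathsf B(l)$, and $\tilde\mu$ is a correction term depending on $(\bar\mu,\hat l)$ and on the half-iteration only. Initially every message is $\mathsf B(l)$.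 Iteration $\ell\ge1$ consists of row-type CN processing followed by column-type CN processing; each variable node (VN) has degree 2 and forwards the message of its row-type CN to its column-type CN and conversely. **Density evolution.** Consider the decoder on the infinite computation tree of a VN, in which each CN carries $\mathcal C$ (with an arbitrary labelling of the CN positions) and the CN types alternate. A random codeword of the tree, whose root bit $c$ takes both values with positive probability, is sent over the bi-AWGN channel. With $\bar\mu^{\mathsf r,(\ell)}$ the BDD output for the root bit in the row half-iteration $\ell$, the correction terms are, recursively over half-iterations, $$\tilde\mu^{\mathsf r,(\ell)}=\ln\frac{p(\bar\mu^{\mathsf r,(\ell)}\mid\hat l,c=0)}{p(\bar\mu^{\mathsf r,(\ell)}\mid\hat l,c=1)},$$ and $\tilde\mu^{\mathsf c,(\ell)}$ is defined likewise from the column half-iteration. Let $x^{\mathsf r,(\ell)}$, $x^{\mathsf c,(\ell)}$ be the probabilities that the row-type resp. column-type CN message on the root bit in iteration $\ell$ is wrong, and $x^{\mathsf c,(0)}$ the probability that $\mathsf B(l)$ is wrong. **Functions.** Assume the all-zero codeword is sent. For $0\le i\le n-1$ let $P^{\mathsf e}(i),P^{\mathsf c}(i),P^{\epsilon}(i)$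 be the probabilities that BDD outputs $-1$, $+1$, $0$ on a uniformly random position which is initially in error, when $i$ errors are placed uniformly at random in the other $n-1$ positions; let $Q^{\mathsf e}(i),Q^{\mathsf c}(i),Q^{\epsilon}(i)$ be the same when the position is initially correct. For each such family $R\in\{P^{\mathsf e},P^{\mathsf c},P^\epsilon,Q^{\mathsf e},Q^{\mathsf c},Q^\epsilon\}$ put $$f^{R}(x)=\sum_{i=0}^{n-1}\binom{n-1}{i}x^i(1-x)^{n-1-i}R(i).$$ Let $\mathsf Q(x)=\frac1{\sqrt{2\pi}}\int_x^\infty e^{-\xi^2/2}\,d\xi$, and $\bar{\mathbb U}(x)=1$ for $x<0$, $\bar{\mathbb U}(x)=0$ otherwise. **Proposition.** 1. For all $\ell\ge1$, with $x=x^{\mathsf c,(\ell-1)}$ for $\tilde\mu^{\mathsf r,(\ell)}$ and $x=x^{\mathsf r,(\ell)}$ for $\tilde\mu^{\mathsf c,(\ell)}$, the correction term is given by: $(\bar\mu,\hat l)=(-1,-1)$: $\ln\frac{f^{P^{\mathsf e}}(x)}{f^{Q^{\mathsf c}}(x)}$; $(1,-1)$: $\ln\frac{f^{P^{\mathsf c}}(x)}{f^{Q^{\mathsf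 e}}(x)}$; $(0,-1)$: $\ln\frac{f^{P^\epsilon}(x)}{f^{Q^\epsilon}(x)}$; $(-1,1)$: $\ln\frac{f^{Q^{\mathsf e}}(x)}{f^{P^{\mathsf c}}(x)}$; $(1,1)$: $\ln\frac{f^{Q^{\mathsf c}}(x)}{f^{P^{\mathsf e}}(x)}$; $(0,1)$: $\ln\frac{f^{Q^\epsilon}(x)}{f^{P^\epsilon}(x)}$. (If numerator and denominator both vanish, the pair does not occur, and both sides are read as $0$.) 2. With the same $x$, $p(\bar\mu\mid\hat l=-1,c=0)$ equals $f^{P^{\mathsf e}}(x),f^{P^{\mathsf c}}(x),f^{P^\epsilon}(x)$ for $\bar\mu=-1,1,0$; $p(\bar\mu\mid\hat l=1,c=0)$ equals $f^{Q^{\mathsf e}}(x),f^{Q^{\mathsf c}}(x),f^{Q^\epsilon}(x)$ for $\bar\mu=-1,1,0$; and $p(\bar\mu\mid\hat l,c=1)=p(-\bar\mu\mid-\hat l,c=0)$. Moreover $P^\epsilon(i)=1-P^{\mathsf e}(i)-P^{\mathsf c}(i)$ and $Q^\epsilon(i)=1-Q^{\mathsf e}(i)-Q^{\mathsf c}(i)$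 for $0\le i\le n-1$. 3. $x^{\mathsf c,(0)}=\mathsf Q(1/\sigma)$, and for all $\ell\ge1$, $x^{\mathsf r,(\ell)}=\mathsf f(x^{\mathsf c,(\ell-1)})$ and $x^{\mathsf c,(\ell)}=\mathsf f(x^{\mathsf r,(\ell)})$, where $$\mathsf f(x)=\sum_{(A,B)}f^{A}(x)\,\mathsf Q\Big(\tfrac\sigma2\max\big(\ln\tfrac{f^{A}(x)}{f^{B}(x)},0\big)+\tfrac1\sigma\Big)+\sum_{(A,B)}f^{B}(x)\Big(\mathsf Q\Big(\tfrac\sigma2\ln\tfrac{f^{B}(x)}{f^{A}(x)}+\tfrac1\sigma\Big)-\mathsf Q\big(\tfrac1\sigma\big)\Big)\bar{\mathbb U}\Big(\ln\tfrac{f^{B}(x)}{f^{A}(x)}\Big),$$ both sums being over $(A,B)\in\{(P^{\mathsf e},Q^{\mathsf c}),(P^{\mathsf c},Q^{\mathsf e}),(P^\epsilon,Q^\epsilon)\}$ (with the same convention for $0/0$). 4. Consider the regular GLDPC ensemble with $M$ row-type and $M$ column-type CNs of degree $n$ carrying $\mathcal C$, and $nM$ VNs of degree 2, each joined to one CN of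 each type by a uniformly random edge permutation (for $M=n$, one permutation gives the product code of $\mathcal C$). Transmit, for each permutation, any codeword of the resulting code, and decode by iBDD-CR with the correction terms of part 1. Then for every $\ell\ge1$ the message error probabilities after the row and the column half-iteration $\ell$, averaged over the permutation, the VNs and the noise, converge to $x^{\mathsf r,(\ell)}$ and $x^{\mathsf c,(\ell)}$ as $M\to\infty$. -/

import Mathlib

open MeasureTheory ProbabilityTheory Filter Topology

namespace IBDDCR

noncomputable section

/-! ## Notation -/

/-- Tail probability of the standard Gaussian distribution. -/
def gaussQ (x : ℝ) : ℝ :=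
  1 / Real.sqrt (2 * Real.pi) * ∫ ξ in Set.Ioi x, Real.exp (-ξ ^ 2 / 2)

/-- The indicator of the negative half-line. -/
def ubar (x : ℝ) : ℝ := if x < 0 then 1 else 0

/-- The antipodal map `0 ↦ +1`, `1 ↦ -1` from bits to real channel inputs. -/
def bpsk (b : ZMod 2) : ℝ := if b = 0 then 1 else -1

/-- The sign of a soft value, in `{±1}` (an exact tie counts as `+1`). -/
def hardSign (l : ℝ) : SignType := if l < 0 then -1 else 1

/-- The hard decision on a soft value: `-1 ↦ 1`, `+1 ↦ 0`. -/
def hardBit (l : ℝ) : ZMod 2 := if l < 0 then 1 else 0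

/-- The channel LLR `(2 / σ²) y` of the bi-AWGN output `y = (-1)^b + z` for bit `b` and noise `z`. -/
def llr (σ : ℝ) (b : ZMod 2) (z : ℝ) : ℝ := 2 / σ ^ 2 * (bpsk b + z)

/-- A combining look-up table at one half-iteration: a real number for each BDD output
in `{-1, 0, 1}` (first argument) and each channel hard decision in `{±1}` (second argument). -/
abbrev Lut := SignType → SignType → ℝ

/-! ## Component code and bounded distance decoding -/

variable {n : ℕ}

/-- Binary linear codes of length `n`. -/
abbrev LinCode (n : ℕ) := Submodule (ZMod 2) (Fin n → ZMod 2)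

/-- Every nonzero codeword has weight at least `2 t + 1`, i.e. `t ≤ ⌊(d_min - 1) / 2⌋`. -/
def CorrectsErrors (C : LinCode n) (t : ℕ) : Prop :=
  ∀ c ∈ C, c ≠ 0 → 2 * t + 1 ≤ hammingNorm c

/-- The permutation automorphism group of the code is transitive on positions. This holds for
every cyclic code, in particular for BCH codes. -/
def HasTransitiveAut (C : LinCode n) : Prop :=
  ∀ i j : Fin n, ∃ τ : Equiv.Perm (Fin n), τ i = j ∧ ∀ c ∈ C, (fun k => c (τ k)) ∈ C

open Classical in
/-- Output on position `j` of the bounded distance decoder of radius `t` with input `y`: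
`(-1)^(c j)` if some codeword `c` lies within Hamming distance `t` of `y` (the transmitted one, or
another one in the case of a miscorrection), and `0` if there is none. The codeword is unique when
`CorrectsErrors C t`. -/
def bdd (C : LinCode n) (t : ℕ) (y : Fin n → ZMod 2) (j : Fin n) : SignType :=
  if ∃ c ∈ C, hammingDist c y ≤ t ∧ c j = 0 then 1
  else if ∃ c ∈ C, hammingDist c y ≤ t ∧ c j = 1 then -1
  else 0

/-- Extrinsic BDD of position `j`: the `j`-th input is replaced by the channel hard decision `r`. -/
def extBdd (C : LinCode n) (t : ℕ) (y : Fin n → ZMod 2) (j : Fin n) (r : ZMod 2) : SignType :=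
  bdd C t (Function.update y j r) j

/-- The message sent by a constraint node on position `j`: the correction term `μ̃`, looked up from
the BDD output and the sign of the channel LLR `l`, is added to `l`, and the sum is hard-decided. -/
def cnMsg (C : LinCode n) (t : ℕ) (μ : Lut) (y : Fin n → ZMod 2) (j : Fin n) (l : ℝ) : ZMod 2 :=
  hardBit (μ (extBdd C t y j (hardBit l)) (hardSign l) + l)

/-! ## Outcome probabilities of BDD for a given number of errors -/

/-- The word with value `a` at position `j`, ones on `S`, and zeros elsewhere. -/
def errWord (a : ZMod 2) (j : Fin n) (S : Finset (Fin n)) : Fin n → ZMod 2 :=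
  fun k => if k = j then a else if k ∈ S then 1 else 0

open Classical in
/-- The all-zero codeword being transmitted: probability that BDD outputs `u` on a uniformly random
position, when that position is initially in error (`a = 1`) or correct (`a = 0`) and `i` errors are
placed uniformly at random in the other `n - 1` positions. -/
def outcomeProb (C : LinCode n) (t : ℕ) (a : ZMod 2) (u : SignType) (i : ℕ) : ℝ :=
  (∑ j : Fin n, (((Finset.univ.erase j).powersetCard i).filter
      (fun S => bdd C t (errWord a j S) j = u)).card : ℝ) / ((n : ℝ) * ((n - 1).choose i : ℝ))

/-- Initially in error, decoded incorrectly. -/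
def Pe (C : LinCode n) (t i : ℕ) : ℝ := outcomeProb C t 1 (-1) i
/-- Initially in error, decoded correctly. -/
def Pc (C : LinCode n) (t i : ℕ) : ℝ := outcomeProb C t 1 1 i
/-- Initially in error, erased. -/
def Pz (C : LinCode n) (t i : ℕ) : ℝ := outcomeProb C t 1 0 i
/-- Initially correct, decoded incorrectly. -/
def Qe (C : LinCode n) (t i : ℕ) : ℝ := outcomeProb C t 0 (-1) i
/-- Initially correct, decoded correctly. -/
def Qc (C : LinCode n) (t i : ℕ) : ℝ := outcomeProb C t 0 1 i
/-- Initially correct, erased. -/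
def Qz (C : LinCode n) (t i : ℕ) : ℝ := outcomeProb C t 0 0 i

/-- Binomial mixture over the number of errors in the other `n - 1` positions. -/
def mix (n : ℕ) (p : ℕ → ℝ) (x : ℝ) : ℝ :=
  ∑ i ∈ Finset.range n, ((n - 1).choose i : ℝ) * x ^ i * (1 - x) ^ (n - 1 - i) * p i

def fPe (C : LinCode n) (t : ℕ) (x : ℝ) : ℝ := mix n (Pe C t) x
def fPc (C : LinCode n) (t : ℕ) (x : ℝ) : ℝ := mix n (Pc C t) x
def fPz (C : LinCode n) (t : ℕ) (x : ℝ) : ℝ := mix n (Pz C t) x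
def fQe (C : LinCode n) (t : ℕ) (x : ℝ) : ℝ := mix n (Qe C t) x
def fQc (C : LinCode n) (t : ℕ) (x : ℝ) : ℝ := mix n (Qc C t) x
def fQz (C : LinCode n) (t : ℕ) (x : ℝ) : ℝ := mix n (Qz C t) x

/-- The closed-form density evolution step at noise standard deviation `σ` and input message error
probability `x`. -/
def deStep (C : LinCode n) (t : ℕ) (σ x : ℝ) : ℝ :=
  fPe C t x * gaussQ (σ / 2 * max (Real.log (fPe C t x / fQc C t x)) 0 + 1 / σ)
  + fPc C t x * gaussQ (σ / 2 * max (Real.log (fPc C t x / fQe C t x)) 0 + 1 / σ)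
  + fPz C t x * gaussQ (σ / 2 * max (Real.log (fPz C t x / fQz C t x)) 0 + 1 / σ)
  + fQe C t x * (gaussQ (σ / 2 * Real.log (fQe C t x / fPc C t x) + 1 / σ) - gaussQ (1 / σ))
      * ubar (Real.log (fQe C t x / fPc C t x))
  + fQc C t x * (gaussQ (σ / 2 * Real.log (fQc C t x / fPe C t x) + 1 / σ) - gaussQ (1 / σ))
      * ubar (Real.log (fQc C t x / fPe C t x))
  + fQz C t x * (gaussQ (σ / 2 * Real.log (fQz C t x / fPz C t x) + 1 / σ) - gaussQ (1 / σ))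
      * ubar (Real.log (fQz C t x / fPz C t x))

/-! ## The computation tree of density evolution

A variable node is addressed by the list of positions that leads to it, the root being `[]`. The
constraint node below the variable node `v` has `v` at position `pos v`, and for `i ≠ pos v` its
position `i` is taken by the variable node `i :: v`. (Addresses with an entry `i = pos v` do not
occur in the tree and never influence a message of a variable node that does.) The labelling `pos`
is arbitrary. The constraint nodes alternate between row type and column type with the depth, and
the root message of half-iteration `h` is computed from messages of half-iteration `h - 1`. Row
processing in iteration `ℓ ≥ 1` is half-iteration `2 ℓ - 1`, column processing is `2 ℓ`. -/

/-- An assignment of bits to the variable nodes of the tree that satisfies all constraint nodes. -/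
def IsTreeCodeword (C : LinCode n) (pos : List (Fin n) → Fin n) (c : List (Fin n) → ZMod 2) :
    Prop :=
  ∀ v, (fun i => if i = pos v then c v else c (i :: v)) ∈ C

/-- The message on variable node `v` after `h` half-iterations of extrinsic iBDD-CR with correction
tables `μ 1, μ 2, …`, given the channel LLRs `l`. -/
def treeMsg (C : LinCode n) (t : ℕ) (pos : List (Fin n) → Fin n) (μ : ℕ → Lut)
    (l : List (Fin n) → ℝ) : ℕ → List (Fin n) → ZMod 2
  | 0, v => hardBit (l v)
  | h + 1, v => cnMsg C t (μ (h + 1)) (fun i => treeMsg C t pos μ l h (i :: v)) (pos v) (l v)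

/-- The BDD output on the root in half-iteration `h + 1`. It depends on `μ 1, …, μ h` only. -/
def treeBdd (C : LinCode n) (t : ℕ) (pos : List (Fin n) → Fin n) (μ : ℕ → Lut)
    (l : List (Fin n) → ℝ) (h : ℕ) : SignType :=
  extBdd C t (fun i => treeMsg C t pos μ l h [i]) (pos []) (hardBit (l []))

section Tree

variable {Ω : Type*} [MeasurableSpace Ω]

/-- Channel LLRs of the random tree codeword `c` under the noise `z`. -/
def treeLlr (σ : ℝ) (c : Ω → List (Fin n) → ZMod 2) (z : Ω → List (Fin n) → ℝ) (ω : Ω) :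
    List (Fin n) → ℝ :=
  fun v => llr σ (c ω v) (z ω v)

/-- Conditional probability that the root BDD output of half-iteration `h + 1` is `u`, given that the
sign of the root channel LLR is `s` and the root bit is `b`. -/
def condBdd (P : Measure Ω) (C : LinCode n) (t : ℕ) (σ : ℝ) (pos : List (Fin n) → Fin n)
    (c : Ω → List (Fin n) → ZMod 2) (z : Ω → List (Fin n) → ℝ) (μ : ℕ → Lut) (h : ℕ)
    (u s : SignType) (b : ZMod 2) : ℝ :=
  (cond P {ω | hardSign (treeLlr σ c z ω []) = s ∧ c ω [] = b}).real
    {ω | treeBdd C t pos μ (treeLlr σ c z ω) h = u}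

/-- Auxiliary recursion for `muTilde`: the tables of the half-iterations `1, …, h` (the others are
still `0`). -/
def muUpTo (P : Measure Ω) (C : LinCode n) (t : ℕ) (σ : ℝ) (pos : List (Fin n) → Fin n)
    (c : Ω → List (Fin n) → ZMod 2) (z : Ω → List (Fin n) → ℝ) : ℕ → ℕ → Lut
  | 0 => fun _ _ _ => 0
  | h + 1 => Function.update (muUpTo P C t σ pos c z h) (h + 1) (fun u s =>
      Real.log (condBdd P C t σ pos c z (muUpTo P C t σ pos c z h) h u s 0
        / condBdd P C t σ pos c z (muUpTo P C t σ pos c z h) h u s 1))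

/-- The LLR correction terms `μ̃` of half-iteration `h ≥ 1`: the log-ratio of the conditional
probabilities of the BDD output of half-iteration `h`, given the channel hard decision and the
transmitted bit being `0` resp. `1`, when all earlier half-iterations used their own correction
terms. -/
def muTilde (P : Measure Ω) (C : LinCode n) (t : ℕ) (σ : ℝ) (pos : List (Fin n) → Fin n)
    (c : Ω → List (Fin n) → ZMod 2) (z : Ω → List (Fin n) → ℝ) (h : ℕ) : Lut :=
  muUpTo P C t σ pos c z h h

/-- The message error probability after `h` half-iterations of iBDD-CR. -/
def msgErr (P : Measure Ω) (C : LinCode n) (t : ℕ) (σ : ℝ) (pos : List (Fin n) → Fin n)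
    (c : Ω → List (Fin n) → ZMod 2) (z : Ω → List (Fin n) → ℝ) (h : ℕ) : ℝ :=
  P.real {ω | treeMsg C t pos (muTilde P C t σ pos c z) (treeLlr σ c z ω) h [] ≠ c ω []}

/-- Message error probability at the output of the row-type constraint nodes in iteration `ℓ ≥ 1`. -/
def rowErr (P : Measure Ω) (C : LinCode n) (t : ℕ) (σ : ℝ) (pos : List (Fin n) → Fin n)
    (c : Ω → List (Fin n) → ZMod 2) (z : Ω → List (Fin n) → ℝ) (ℓ : ℕ) : ℝ :=
  msgErr P C t σ pos c z (2 * ℓ - 1)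

/-- Message error probability at the output of the column-type constraint nodes in iteration `ℓ`;
for `ℓ = 0`, of the channel hard decisions. -/
def colErr (P : Measure Ω) (C : LinCode n) (t : ℕ) (σ : ℝ) (pos : List (Fin n) → Fin n)
    (c : Ω → List (Fin n) → ZMod 2) (z : Ω → List (Fin n) → ℝ) (ℓ : ℕ) : ℝ :=
  msgErr P C t σ pos c z (2 * ℓ)

end Tree

/-! ## The regular GLDPC ensemble

`M` row-type and `M` column-type constraint nodes with `n` sockets each, and `n M` variable nodes of
degree 2. A variable node is identified with its row socket, and the edge permutation `π` maps it to
its column socket. -/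

/-- The member of the ensemble given by the edge permutation `π`. -/
def gldpcCode {M : ℕ} (C : LinCode n) (π : Equiv.Perm (Fin M × Fin n)) :
    Set (Fin M × Fin n → ZMod 2) :=
  {c | (∀ a, (fun i => c (a, i)) ∈ C) ∧ ∀ b, (fun i => c (π.symm (b, i))) ∈ C}

/-- Product codes (arrays all of whose rows and columns are component codewords) are members. -/
theorem productCode_mem_ensemble (C : LinCode n) :
    gldpcCode C (Equiv.prodComm (Fin n) (Fin n)) =
      {c | (∀ a, (fun i => c (a, i)) ∈ C) ∧ ∀ b, (fun i => c (i, b)) ∈ C} := rfl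

/-- The message on a variable node after `h` half-iterations of extrinsic iBDD-CR on the graph of
`π`; the odd half-iterations process rows, the even ones columns. -/
def ensMsg {M : ℕ} (C : LinCode n) (t : ℕ) (π : Equiv.Perm (Fin M × Fin n)) (μ : ℕ → Lut)
    (l : Fin M × Fin n → ℝ) : ℕ → Fin M × Fin n → ZMod 2
  | 0, e => hardBit (l e)
  | h + 1, e =>
    if Even h then
      cnMsg C t (μ (h + 1)) (fun i => ensMsg C t π μ l h (e.1, i)) e.2 (l e)
    else
      cnMsg C t (μ (h + 1)) (fun i => ensMsg C t π μ l h (π.symm ((π e).1, i))) (π e).2 (l e)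

/-- The message error probability after `h` half-iterations, averaged over the ensemble with `M`
row and `M` column constraint nodes (uniformly random edge permutation), over a uniformly random
variable node, and over the noise, if `c π` is transmitted over the graph of `π`. -/
def ensErr (C : LinCode n) (t : ℕ) (σ : ℝ) (μ : ℕ → Lut) (M : ℕ)
    (c : Equiv.Perm (Fin M × Fin n) → Fin M × Fin n → ZMod 2) (h : ℕ) : ℝ :=
  (∑ π : Equiv.Perm (Fin M × Fin n), ∑ e : Fin M × Fin n,
    (Measure.pi (fun _ : Fin M × Fin n => gaussianReal 0 (σ ^ 2).toNNReal)).real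
      {z | ensMsg C t π μ (fun e' => llr σ (c π e') (z e')) h e ≠ c π e})
    / (Fintype.card (Equiv.Perm (Fin M × Fin n)) * Fintype.card (Fin M × Fin n))

end

end IBDDCR

open IBDDCR

namespace IBDDCR

noncomputable section

variable {n : ℕ}

/-! Two symmetries remove the transmitted word. Translating the BDD input by a codeword only
multiplies the output by a sign (`bdd_add`), and the noise law is even (`noiseLaw_errSet_flip`).
Hence, if the correction tables change sign when both arguments do (`OddLut`), the error probability
of a message does not depend on the codeword, and only error patterns matter. At a node whose
dependency sets form a tree, the incoming messages are wrong independently with a common probability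
`x`, and independently of the node's own noise. The error pattern is therefore Bernoulli, and
transitivity of the automorphism group turns its BDD outcome probabilities into the mixtures `mix n
(outcomeProb C t a u) x`, whatever the position (`mix_outcomeProb`). Splitting by BDD outcome and by
correctness of the channel hard decision gives `oneStep`, with explicit Gaussian tails.

The tables are themselves defined by probabilities on the tree, so their closed form and their
oddness are proved together by strong induction: oddness up to half-iteration `h` gives the
conditional laws (`condBdd_eq_mix`), these give the next table (`optLut_muTilde_succ`), and that
table is odd because the symmetry exchanges numerator and denominator. The random codeword is
integrated out by Fubini, each fixed codeword giving the same value.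

The tree and the finite graphs are instances of one recursion, `genMsg`. On a tree-like
neighbourhood of a finite graph the error probability is exactly that of the tree, so the limit only
requires that cycles of bounded depth be rare. A switching argument shows this: exchanging a socket
at the first collision with one outside the ball bounds the number of collisions
(`card_collisions_mul_le`). It is run with two free permutations, and relabelling the variable nodes
transfers it to the ensemble, which has only one. -/

/-! ## Symmetries of bounded distance decoding -/

/-- The antipodal map from bits to signs. -/
def bitSign (a : ZMod 2) : SignType := if a = 0 then 1 else -1

@[simp] theorem bitSign_zero : bitSign 0 = 1 := by simp [bitSign]
@[simp] theorem bitSign_one : bitSign 1 = -1 := by simp [bitSign]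

theorem zmod2_cases (a : ZMod 2) : a = 0 ∨ a = 1 := by
  revert a; decide

theorem hardSign_eq (l : ℝ) : hardSign l = bitSign (hardBit l) := by
  unfold hardSign hardBit; split_ifs <;> simp

theorem bitSign_injective : Function.Injective bitSign := by
  unfold Function.Injective; decide

/-- Some codeword in the decoding ball of `y` has value `a` at position `j`. -/
def Decodes (C : LinCode n) (t : ℕ) (y : Fin n → ZMod 2) (j : Fin n) (a : ZMod 2) : Prop :=
  ∃ c ∈ C, hammingDist c y ≤ t ∧ c j = a

theorem bdd_eq_ite (C : LinCode n) (t : ℕ) (y : Fin n → ZMod 2) (j : Fin n)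
    [Decidable (Decodes C t y j 0)] [Decidable (Decodes C t y j 1)] :
    bdd C t y j = if Decodes C t y j 0 then 1 else if Decodes C t y j 1 then -1 else 0 := by
  unfold bdd Decodes
  congr

/-- Two codewords within `t` of `y` are at distance at most `2 * t`, hence equal. -/
theorem Decodes.unique {C : LinCode n} {t : ℕ} (hC : CorrectsErrors C t) {y : Fin n → ZMod 2}
    {j : Fin n} {a b : ZMod 2} (ha : Decodes C t y j a) (hb : Decodes C t y j b) : a = b := by
  obtain ⟨c, hc, hcd, rfl⟩ := ha
  obtain ⟨d, hd, hdd, rfl⟩ := hb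
  by_contra hne
  have hcd0 : -c + d ≠ 0 := fun h => hne (by rw [neg_add_eq_zero.1 h])
  have h1 := hC (-c + d) (C.add_mem (C.neg_mem hc) hd) hcd0
  have h2 := hammingDist_triangle_right c d y
  rw [hammingDist_eq_hammingNorm] at h2
  omega

/-- Translation by a codeword is a Hamming isometry that preserves the code. -/
theorem decodes_add {C : LinCode n} {t : ℕ} {b : Fin n → ZMod 2} (hb : b ∈ C)
    (y : Fin n → ZMod 2) (j : Fin n) (a : ZMod 2) :
    Decodes C t (y + b) j (a + b j) ↔ Decodes C t y j a := by
  constructor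
  · rintro ⟨c, hc, hd, hj⟩
    refine ⟨c - b, C.sub_mem hc hb, ?_, by simp [hj]⟩
    rw [hammingDist_eq_hammingNorm] at hd ⊢
    rwa [show -(c - b) + y = -c + (y + b) by abel]
  · rintro ⟨c, hc, hd, hj⟩
    refine ⟨c + b, C.add_mem hc hb, ?_, by simp [hj]⟩
    rw [hammingDist_eq_hammingNorm] at hd ⊢
    rwa [show -(c + b) + (y + b) = -c + y by abel]

/-- If `b j = 1`, translation exchanges the two tests in `bdd`. Uniqueness of the decoded value
makes the order of the tests irrelevant. -/
theorem bdd_add {C : LinCode n} {t : ℕ} (hC : CorrectsErrors C t) {b : Fin n → ZMod 2}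
    (hb : b ∈ C) (y : Fin n → ZMod 2) (j : Fin n) :
    bdd C t (y + b) j = bitSign (b j) * bdd C t y j := by
  classical
  have h0 := decodes_add (t := t) hb y j 0
  have h1 := decodes_add (t := t) hb y j 1
  have hu : Decodes C t y j 0 → ¬ Decodes C t y j 1 := fun h h' =>
    absurd (h.unique hC h') (by decide)
  rw [bdd_eq_ite, bdd_eq_ite]
  rcases zmod2_cases (b j) with h | h <;> rw [h] at h0 h1 ⊢
  · rw [add_zero] at h0 h1
    simp [h0, h1]
  · rw [zero_add] at h0
    rw [show (1 : ZMod 2) + 1 = 0 by decide] at h1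
    simp only [h0, h1, bitSign_one]
    by_cases p : Decodes C t y j 0 <;> by_cases q : Decodes C t y j 1 <;> simp_all

theorem hammingDist_comp_perm (τ : Equiv.Perm (Fin n)) (x y : Fin n → ZMod 2) :
    hammingDist (fun k => x (τ k)) (fun k => y (τ k)) = hammingDist x y := by
  unfold hammingDist
  refine Finset.card_bij (fun k _ => τ k) ?_ ?_ ?_
  · intro a ha; simpa using ha
  · intro a _ b _ h; exact τ.injective h
  · intro a ha; exact ⟨τ.symm a, by simpa using ha, by simp⟩

theorem bdd_comp_perm {C : LinCode n} (t : ℕ) {τ : Equiv.Perm (Fin n)}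
    (hτ : ∀ c ∈ C, (fun k => c (τ k)) ∈ C) (y : Fin n → ZMod 2) (j : Fin n) :
    bdd C t (fun k => y (τ k)) j = bdd C t y (τ j) := by
  classical
  have key : ∀ a, Decodes C t (fun k => y (τ k)) j a ↔ Decodes C t y (τ j) a := by
    intro a
    constructor
    · rintro ⟨c, hc, hd, hj⟩
      -- The hypothesis only says that `τ` maps the code into itself; injectivity on a finite code
      -- makes the map onto, so `c` can be pulled back.
      have hinj : Function.Injective
          (fun c : C => (⟨fun k => c.1 (τ k), hτ c.1 c.2⟩ : C)) := by
        intro c d h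
        ext k
        have := congrFun (congrArg Subtype.val h) (τ.symm k)
        simpa using this
      obtain ⟨⟨d, hdC⟩, hd'⟩ := (Finite.injective_iff_surjective.1 hinj) ⟨c, hc⟩
      have hcd : c = fun k => d (τ k) := (congrArg Subtype.val hd').symm
      subst hcd
      exact ⟨d, hdC, by rwa [hammingDist_comp_perm] at hd, hj⟩
    · rintro ⟨c, hc, hd, hj⟩
      exact ⟨fun k => c (τ k), hτ c hc, by rwa [hammingDist_comp_perm], hj⟩
  rw [bdd_eq_ite, bdd_eq_ite]
  simp only [key]

/-! ## The binomial mixtures -/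

open Classical in
/-- Number of `i`-subsets of the other positions for which BDD outputs `u` on position `j`. -/
def outcomeCount (C : LinCode n) (t : ℕ) (a : ZMod 2) (u : SignType) (j : Fin n) (i : ℕ) : ℕ :=
  (((Finset.univ.erase j).powersetCard i).filter
      (fun S => bdd C t (errWord a j S) j = u)).card

theorem errWord_map (a : ZMod 2) (i : Fin n) (τ : Equiv.Perm (Fin n)) (S : Finset (Fin n)) :
    errWord a i S = fun k => errWord a (τ i) (S.map τ.toEmbedding) (τ k) := by
  ext k
  simp [errWord]

/-- An automorphism carrying `i` to `j` carries error patterns around `i` to error patterns around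
`j` and commutes with BDD. -/
theorem outcomeCount_eq {C : LinCode n} (hCt : HasTransitiveAut C) (t : ℕ) (a : ZMod 2)
    (u : SignType) (i j : Fin n) (m : ℕ) :
    outcomeCount C t a u i m = outcomeCount C t a u j m := by
  classical
  obtain ⟨τ, rfl, hτ⟩ := hCt i j
  unfold outcomeCount
  refine Finset.card_bij (fun S _ => S.map τ.toEmbedding) ?_ ?_ ?_
  · intro S hS
    simp only [Finset.mem_filter, Finset.mem_powersetCard, Finset.card_map] at hS ⊢
    refine ⟨⟨?_, hS.1.2⟩, ?_⟩
    · intro k hk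
      obtain ⟨k', hk', rfl⟩ := Finset.mem_map.1 hk
      have := hS.1.1 hk'
      simpa using this
    · rw [← hS.2, errWord_map a i τ S, bdd_comp_perm t hτ]
  · intro S _ T _ h
    exact Finset.map_injective _ h
  · intro S hS
    simp only [Finset.mem_filter, Finset.mem_powersetCard] at hS
    have hmap : (S.map τ.symm.toEmbedding).map τ.toEmbedding = S := by
      ext k; simp
    refine ⟨S.map τ.symm.toEmbedding, ?_, hmap⟩
    simp only [Finset.mem_filter, Finset.mem_powersetCard, Finset.card_map]
    refine ⟨⟨?_, hS.1.2⟩, ?_⟩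
    · intro k hk
      obtain ⟨k', hk', rfl⟩ := Finset.mem_map.1 hk
      have := hS.1.1 hk'
      simp only [Finset.mem_erase, Finset.mem_univ, and_true] at this ⊢
      intro h
      exact this (by rw [← h]; simp)
    · rw [errWord_map a i τ, bdd_comp_perm t hτ, hmap]; exact hS.2

theorem outcomeProb_eq {C : LinCode n} (hCt : HasTransitiveAut C) (t : ℕ) (a : ZMod 2)
    (u : SignType) (j : Fin n) (m : ℕ) :
    outcomeProb C t a u m = outcomeCount C t a u j m / ((n - 1).choose m : ℝ) := by
  classical
  have hn : (n : ℝ) ≠ 0 := by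
    have := j.pos
    positivity
  have h : (∑ i : Fin n, (outcomeCount C t a u i m : ℝ)) = n * outcomeCount C t a u j m := by
    rw [Finset.sum_congr rfl (fun i _ => by rw [outcomeCount_eq hCt t a u i j m])]
    simp
  rw [← mul_div_mul_left (outcomeCount C t a u j m : ℝ) _ hn, ← h]
  rfl

-- The binomial coefficient in `mix` cancels the normalisation of `outcomeProb`, leaving Bernoulli
-- weights of individual patterns. In this form the mixture meets the law of the error pattern at a
-- constraint node.
open Classical in
theorem mix_outcomeProb {C : LinCode n} (hCt : HasTransitiveAut C) (t : ℕ) (a : ZMod 2)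
    (u : SignType) (j : Fin n) (x : ℝ) :
    mix n (outcomeProb C t a u) x = ∑ S ∈ ((Finset.univ.erase j).powerset).filter
      (fun S => bdd C t (errWord a j S) j = u), x ^ S.card * (1 - x) ^ (n - 1 - S.card) := by
  have hn := j.pos
  rw [Finset.sum_filter, Finset.sum_powerset]
  have hcard : (Finset.univ.erase j).card + 1 = n := by
    rw [Finset.card_erase_of_mem (Finset.mem_univ _), Finset.card_univ, Fintype.card_fin]; omega
  rw [hcard]
  unfold mix
  refine Finset.sum_congr rfl fun i hi => ?_
  have hch : ((n - 1).choose i : ℝ) ≠ 0 := by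
    have : 0 < (n - 1).choose i := Nat.choose_pos (by have := Finset.mem_range.1 hi; omega)
    positivity
  rw [outcomeProb_eq hCt t a u j, ← Finset.sum_filter, outcomeCount]
  rw [Finset.sum_congr rfl (g := fun _ => x ^ i * (1 - x) ^ (n - 1 - i))]
  · rw [Finset.sum_const, nsmul_eq_mul]
    field_simp
  · intro S hS
    rw [(Finset.mem_powersetCard.1 (Finset.mem_filter.1 hS).1).2]

/-- The three BDD outcomes partition the `i`-subsets; `i < n` keeps the normalising binomial
coefficient nonzero. -/
theorem outcomeProb_zero_eq {C : LinCode n} (t : ℕ) (a : ZMod 2) {i : ℕ} (hi : i < n) :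
    outcomeProb C t a 0 i = 1 - outcomeProb C t a (-1) i - outcomeProb C t a 1 i := by
  classical
  have hn : 0 < n := by omega
  have hpos : (0 : ℝ) < (n : ℝ) * ((n - 1).choose i : ℝ) := by
    have : 0 < (n - 1).choose i := Nat.choose_pos (by omega)
    positivity
  have hsum : ∀ j : Fin n, (outcomeCount C t a 0 j i : ℝ) + outcomeCount C t a (-1) j i
      + outcomeCount C t a 1 j i = (n - 1).choose i := by
    intro j
    have h := Finset.card_eq_sum_card_fiberwise (f := fun S => bdd C t (errWord a j S) j)
      (s := (Finset.univ.erase j).powersetCard i) (t := Finset.univ) (by intro; simp)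
    rw [Finset.card_powersetCard, Finset.card_erase_of_mem (Finset.mem_univ _), Finset.card_univ,
      Fintype.card_fin] at h
    rw [show (Finset.univ : Finset SignType) = {0, -1, 1} from rfl] at h
    rw [Finset.sum_insert (by decide), Finset.sum_insert (by decide), Finset.sum_singleton] at h
    rw [h]
    unfold outcomeCount
    push_cast
    ring
  have htot : (∑ j : Fin n, (outcomeCount C t a 0 j i : ℝ)) +
      (∑ j : Fin n, (outcomeCount C t a (-1) j i : ℝ)) +
      (∑ j : Fin n, (outcomeCount C t a 1 j i : ℝ)) = n * (n - 1).choose i := by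
    rw [← Finset.sum_add_distrib, ← Finset.sum_add_distrib, Finset.sum_congr rfl
      (fun j _ => hsum j)]
    simp
  have hdef : ∀ u, outcomeProb C t a u i = (∑ j : Fin n, (outcomeCount C t a u j i : ℝ)) /
      ((n : ℝ) * ((n - 1).choose i : ℝ)) := fun u => rfl
  rw [hdef, hdef, hdef, sub_sub, eq_sub_iff_add_eq, ← add_div, ← add_div,
    div_eq_one_iff_eq hpos.ne']
  linarith

/-! ## Gaussian computations -/

/-- The law of the channel noise. -/
abbrev noiseLaw (σ : ℝ) : Measure ℝ := gaussianReal 0 (σ ^ 2).toNNReal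

theorem gaussianReal_real_Ioi (x : ℝ) : (gaussianReal 0 1).real (Set.Ioi x) = gaussQ x := by
  rw [measureReal_def, gaussianReal_apply_eq_integral 0 one_ne_zero, ENNReal.toReal_ofReal
    (integral_nonneg fun y => gaussianPDFReal_nonneg _ _ _)]
  unfold gaussQ
  rw [← integral_const_mul]
  refine integral_congr_ae (Eventually.of_forall fun y => ?_)
  simp [gaussianPDFReal]

theorem noiseLaw_eq_map (σ : ℝ) :
    noiseLaw σ = (gaussianReal 0 1).map (fun x => σ * x) := by
  rw [gaussianReal_map_const_mul]
  have h : (σ ^ 2).toNNReal = NNReal.mk (σ ^ 2) (sq_nonneg σ) * 1 := by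
    rw [mul_one]; exact Real.toNNReal_of_nonneg (sq_nonneg σ)
  rw [mul_zero, noiseLaw, h]

theorem noiseLaw_real_Iio {σ : ℝ} (hσ : 0 < σ) (y : ℝ) :
    (noiseLaw σ).real (Set.Iio (-y)) = gaussQ (y / σ) := by
  have hneg : (noiseLaw σ).map (fun x => -x) = noiseLaw σ := by
    rw [gaussianReal_map_neg, neg_zero]
  rw [← hneg, map_measureReal_apply measurable_neg measurableSet_Iio, noiseLaw_eq_map,
    map_measureReal_apply (by fun_prop) (measurable_neg measurableSet_Iio),
    ← gaussianReal_real_Ioi]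
  congr 1
  ext z
  simp only [Set.mem_preimage, Set.mem_Iio, Set.mem_Ioi, neg_lt_neg_iff]
  rw [div_lt_iff₀ hσ, mul_comm]

theorem llr_add_neg_iff {σ : ℝ} (hσ : 0 < σ) (a z : ℝ) :
    a + llr σ 0 z < 0 ↔ z < -(a * σ ^ 2 / 2 + 1) := by
  have h2 : (0 : ℝ) < σ ^ 2 := by positivity
  have : a + llr σ 0 z = 2 / σ ^ 2 * (z + (a * σ ^ 2 / 2 + 1)) := by
    simp only [llr, bpsk, if_true]
    field_simp
    ring
  rw [this]
  have h3 : (0 : ℝ) < 2 / σ ^ 2 := by positivity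
  constructor
  · intro h
    by_contra hh
    have : 0 ≤ 2 / σ ^ 2 * (z + (a * σ ^ 2 / 2 + 1)) := mul_nonneg h3.le (by linarith)
    linarith
  · intro h
    exact mul_neg_of_pos_of_neg h3 (by linarith)

/-- For bit `0` the LLR is Gaussian with mean `2 / σ ^ 2` and standard deviation `2 / σ`;
standardising the threshold `-a` yields the argument of `gaussQ`. -/
theorem noiseLaw_llr_lt {σ : ℝ} (hσ : 0 < σ) (a : ℝ) :
    (noiseLaw σ).real {z | a + llr σ 0 z < 0} = gaussQ (σ / 2 * a + 1 / σ) := by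
  simp only [llr_add_neg_iff hσ]
  rw [show {z | z < -(a * σ ^ 2 / 2 + 1)} = Set.Iio (-(a * σ ^ 2 / 2 + 1)) from rfl,
    noiseLaw_real_Iio hσ]
  congr 1
  field_simp

theorem hardBit_eq_one (l : ℝ) : hardBit l = 1 ↔ l < 0 := by
  unfold hardBit; split_ifs with h <;> simp [h]

theorem hardBit_eq_zero (l : ℝ) : hardBit l = 0 ↔ 0 ≤ l := by
  unfold hardBit; split_ifs with h <;> simp at h ⊢ <;> linarith

theorem measurable_hardBit : Measurable hardBit := by
  unfold hardBit
  exact Measurable.ite measurableSet_Iio measurable_const measurable_const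

theorem measurable_llr (σ : ℝ) (b : ZMod 2) : Measurable (llr σ b) := by
  unfold llr; fun_prop

/-- Noise values for which bit `b` is hard-decided as `b + a`, but as `b + 1` after the
correction term `m` has been added to the LLR. -/
def errSet (σ : ℝ) (b a : ZMod 2) (m : ℝ) : Set ℝ :=
  {z | hardBit (llr σ b z) = b + a ∧ hardBit (m + llr σ b z) = b + 1}

theorem measurableSet_errSet (σ : ℝ) (b a : ZMod 2) (m : ℝ) :
    MeasurableSet (errSet σ b a m) := by
  have h1 : Measurable fun z => hardBit (llr σ b z) := measurable_hardBit.comp (measurable_llr σ b)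
  have h2 : Measurable fun z => hardBit (m + llr σ b z) :=
    measurable_hardBit.comp ((measurable_llr σ b).const_add m)
  exact (h1 (measurableSet_singleton _)).inter (h2 (measurableSet_singleton _))

/-- The LLR is negative both before and after adding `m`, and the larger of `m` and `0` decides
which condition binds. -/
theorem noiseLaw_errSet_one {σ : ℝ} (hσ : 0 < σ) (m : ℝ) :
    (noiseLaw σ).real (errSet σ 0 1 m) = gaussQ (σ / 2 * max m 0 + 1 / σ) := by
  rw [← noiseLaw_llr_lt hσ]
  congr 1
  ext z
  simp only [errSet, zero_add, hardBit_eq_one, Set.mem_ofPred_eq]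
  rcases max_cases m 0 with ⟨h, h'⟩ | ⟨h, h'⟩ <;> rw [h] <;> constructor
  · exact fun h => h.2
  · exact fun h => ⟨by linarith, h⟩
  · rintro ⟨h1, h2⟩; linarith
  · exact fun h => ⟨by linarith, by linarith⟩

/-- A nonnegative LLR becomes negative only if `m < 0`, whence `ubar`; the event is then a
difference of two nested tails. -/
theorem noiseLaw_errSet_zero {σ : ℝ} (hσ : 0 < σ) (m : ℝ) :
    (noiseLaw σ).real (errSet σ 0 0 m) =
      (gaussQ (σ / 2 * m + 1 / σ) - gaussQ (1 / σ)) * ubar m := by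
  unfold ubar
  split_ifs with hm
  · rw [mul_one, ← noiseLaw_llr_lt hσ m]
    have h0 := noiseLaw_llr_lt hσ 0
    rw [mul_zero, zero_add] at h0
    rw [← h0, ← measureReal_sdiff (by
      intro z hz
      simp only [Set.mem_ofPred_eq] at hz ⊢
      linarith) (by
        have := measurable_llr σ 0
        exact measurableSet_lt (by fun_prop) measurable_const)]
    congr 1
    ext z
    simp only [errSet, zero_add, hardBit_eq_one, hardBit_eq_zero, Set.mem_ofPred_eq, Set.mem_sdiff,
      not_lt]
    exact and_comm
  · rw [mul_zero]
    convert measureReal_empty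
    ext z
    simp only [errSet, zero_add, hardBit_eq_one, hardBit_eq_zero, Set.mem_ofPred_eq,
      Set.mem_empty_iff_false, iff_false, not_and, not_lt]
    intro h
    linarith

theorem hardBit_neg {l : ℝ} (hl : l ≠ 0) : hardBit (-l) = hardBit l + 1 := by
  rcases lt_or_gt_of_ne hl with h | h
  · rw [(hardBit_eq_one l).2 h, (hardBit_eq_zero _).2 (by linarith)]; decide
  · rw [(hardBit_eq_zero l).2 h.le, (hardBit_eq_one _).2 (by linarith)]; decide

theorem noiseLaw_nullSingleton {σ : ℝ} (hσ : 0 < σ) : NullSingletonClass (noiseLaw σ) :=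
  nullSingletonClass_gaussianReal (by simpa using hσ.ne')

/-- Channel symmetry: flipping the bit and the correction term does not change the probability. -/
theorem noiseLaw_errSet_flip {σ : ℝ} (hσ : 0 < σ) (a : ZMod 2) (m : ℝ) :
    (noiseLaw σ).real (errSet σ 1 a (-m)) = (noiseLaw σ).real (errSet σ 0 a m) := by
  have := noiseLaw_nullSingleton hσ
  have hneg : (noiseLaw σ).map (fun x => -x) = noiseLaw σ := by
    rw [gaussianReal_map_neg, neg_zero]
  conv_lhs => rw [← hneg]
  rw [map_measureReal_apply measurable_neg (measurableSet_errSet _ _ _ _)]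
  refine measureReal_congr ?_
  -- The tie rule at `0` favours bit `0` and breaks the symmetry, but each of the two ties occurs at
  -- a single noise value.
  have hnull : ∀ k : ℝ, ∀ᵐ z ∂(noiseLaw σ), k + llr σ 0 z ≠ 0 := by
    intro k
    have : {z | k + llr σ 0 z = 0}.Subsingleton := by
      intro x hx y hy
      simp only [llr, Set.mem_ofPred_eq] at hx hy
      have h2 : (2 / σ ^ 2) ≠ 0 := by positivity
      have h3 : 2 / σ ^ 2 * x = 2 / σ ^ 2 * y := by linarith
      exact mul_left_cancel₀ h2 h3
    rw [ae_iff]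
    simpa using this.measure_zero (noiseLaw σ)
  filter_upwards [hnull 0, hnull m] with z hz0 hzm
  rw [zero_add] at hz0
  have hl : llr σ 1 (-z) = - llr σ 0 z := by
    simp [llr, bpsk]; ring
  change (hardBit (llr σ 1 (-z)) = 1 + a ∧ hardBit (-m + llr σ 1 (-z)) = 1 + 1) =
    (hardBit (llr σ 0 z) = 0 + a ∧ hardBit (m + llr σ 0 z) = 0 + 1)
  rw [hl, ← neg_add, hardBit_neg hz0, hardBit_neg hzm, add_comm, add_right_inj, add_left_inj,
    zero_add, zero_add]

/-! ## The density evolution step for arbitrary correction terms -/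

/-- Probability that a constraint node message is wrong if the incoming messages are wrong with
probability `x`. -/
def oneStep (C : LinCode n) (t : ℕ) (σ : ℝ) (μ : Lut) (x : ℝ) : ℝ :=
  ∑ u : SignType, ∑ a : ZMod 2,
    (noiseLaw σ).real (errSet σ 0 a (μ u (bitSign a))) * mix n (outcomeProb C t a u) x

theorem sum_signType (f : SignType → ℝ) : ∑ u, f u = f 0 + f (-1) + f 1 := by
  rw [show (Finset.univ : Finset SignType) = {0, -1, 1} from rfl]
  rw [Finset.sum_insert (by decide), Finset.sum_insert (by decide), Finset.sum_singleton]
  ring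

theorem sum_zmod2 (f : ZMod 2 → ℝ) : ∑ u, f u = f 0 + f 1 := Fin.sum_univ_two f

/-- The correction terms for input message error probability `x`. -/
def optLut (C : LinCode n) (t : ℕ) (x : ℝ) (μ : Lut) : Prop :=
  μ (-1) (-1) = Real.log (fPe C t x / fQc C t x) ∧
  μ 1 (-1) = Real.log (fPc C t x / fQe C t x) ∧
  μ 0 (-1) = Real.log (fPz C t x / fQz C t x) ∧
  μ (-1) 1 = Real.log (fQe C t x / fPc C t x) ∧
  μ 1 1 = Real.log (fQc C t x / fPe C t x) ∧
  μ 0 1 = Real.log (fQz C t x / fPz C t x)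

/-- The pairs with `a = 1` give the terms with `max`, those with `a = 0` the terms with `ubar`. -/
theorem oneStep_eq_deStep (C : LinCode n) (t : ℕ) {σ : ℝ} (hσ : 0 < σ) {μ : Lut} {x : ℝ}
    (h : optLut C t x μ) : oneStep C t σ μ x = deStep C t σ x := by
  obtain ⟨h1, h2, h3, h4, h5, h6⟩ := h
  unfold oneStep deStep
  rw [sum_signType]
  simp only [sum_zmod2, bitSign_zero, bitSign_one, noiseLaw_errSet_one hσ,
    noiseLaw_errSet_zero hσ, h1, h2, h3, h4, h5, h6]
  rw [show mix n (outcomeProb C t 0 0) x = fQz C t x from rfl,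
    show mix n (outcomeProb C t 0 (-1)) x = fQe C t x from rfl,
    show mix n (outcomeProb C t 0 1) x = fQc C t x from rfl,
    show mix n (outcomeProb C t 1 0) x = fPz C t x from rfl,
    show mix n (outcomeProb C t 1 (-1)) x = fPe C t x from rfl,
    show mix n (outcomeProb C t 1 1) x = fPc C t x from rfl]
  ring

/-- Antipodal symmetry of a correction table. -/
def OddLut (μ : Lut) : Prop :=
  ∀ u : SignType, ∀ a : ZMod 2, μ (-u) (bitSign (a + 1)) = -μ u (bitSign a)

/-- Antipodal entries have numerator and denominator exchanged. The identity survives vanishing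
mixtures, since `Real.log_inv` and `inv_div` hold with the default values at `0`. -/
theorem optLut.odd {C : LinCode n} {t : ℕ} {x : ℝ} {μ : Lut} (h : optLut C t x μ) :
    OddLut μ := by
  obtain ⟨h1, h2, h3, h4, h5, h6⟩ := h
  have hl : ∀ p q : ℝ, Real.log (p / q) = - Real.log (q / p) := fun p q => by
    rw [← Real.log_inv, inv_div]
  have e : (1 : ZMod 2) + 1 = 0 := by decide
  intro u a
  rcases zmod2_cases a with rfl | rfl <;> cases u <;>
    simp only [e, zero_add, bitSign_zero, bitSign_one, SignType.zero_eq_zero,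
      SignType.neg_eq_neg_one, SignType.pos_eq_one, neg_neg, neg_zero, h1, h2, h3, h4, h5, h6] <;>
    apply hl

/-! ## Events that depend on finitely many noise variables -/

section Blocks

variable {ι : Type*}

/-- Membership in `E` is determined by the coordinates in `D`. -/
def SetDependsOn (E : Set (ι → ℝ)) (D : Finset ι) : Prop :=
  ∀ l l' : ι → ℝ, (∀ v ∈ D, l v = l' v) → (l ∈ E → l' ∈ E)

variable {Ω : Type*} [MeasurableSpace Ω] {P : Measure Ω} {z : ι → Ω → ℝ}

/-- Extension of a vector indexed by a finite set by zeros. -/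
def extendZero (D : Finset ι) [DecidablePred (· ∈ D)] (y : D → ℝ) : ι → ℝ :=
  fun v => if h : v ∈ D then y ⟨v, h⟩ else 0

theorem measurable_extendZero (D : Finset ι) [DecidablePred (· ∈ D)] :
    Measurable (extendZero D) := by
  refine measurable_pi_lambda _ fun v => ?_
  unfold extendZero
  by_cases h : v ∈ D
  · simp only [h, dif_pos]; fun_prop
  · simp only [h, dif_neg, not_false_iff]; fun_prop

/-- Subfamilies over disjoint finite index sets are independent. Since the events ignore all other
coordinates, filling these with zeros expresses each event through its subfamily. -/
theorem measure_inter_of_disjoint (hz : ∀ v, Measurable (z v)) (hind : iIndepFun z P)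
    {E F : Set (ι → ℝ)} (hE : MeasurableSet E) (hF : MeasurableSet F) {D D' : Finset ι}
    (hED : SetDependsOn E D) (hFD : SetDependsOn F D') (hD : Disjoint D D') :
    P ({ω | (fun v => z v ω) ∈ E} ∩ {ω | (fun v => z v ω) ∈ F}) =
      P {ω | (fun v => z v ω) ∈ E} * P {ω | (fun v => z v ω) ∈ F} := by
  classical
  have h := (hind.indepFun_finset D D' hD hz).measure_inter_preimage_eq_mul
    (extendZero D ⁻¹' E) (extendZero D' ⁻¹' F)
    (measurable_extendZero D hE) (measurable_extendZero D' hF)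
  have key : ∀ (E : Set (ι → ℝ)) (D : Finset ι), SetDependsOn E D →
      (fun (a : Ω) (i : D) => z i a) ⁻¹' (extendZero D ⁻¹' E) = {ω | (fun v => z v ω) ∈ E} := by
    intro E D hED
    ext ω
    constructor
    · exact hED _ _ fun v hv => by simp [extendZero, hv]
    · exact hED _ _ fun v hv => by simp [extendZero, hv]
  rwa [key E D hED, key F D' hFD] at h

theorem measure_iInter_of_pairwiseDisjoint [IsProbabilityMeasure P] (hz : ∀ v, Measurable (z v))
    (hind : iIndepFun z P) {κ : Type*} (s : Finset κ) {E : κ → Set (ι → ℝ)}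
    (hE : ∀ i, MeasurableSet (E i)) {D : κ → Finset ι} (hED : ∀ i, SetDependsOn (E i) (D i))
    (hD : ∀ i ∈ s, ∀ j ∈ s, i ≠ j → Disjoint (D i) (D j)) :
    P {ω | ∀ i ∈ s, (fun v => z v ω) ∈ E i} = ∏ i ∈ s, P {ω | (fun v => z v ω) ∈ E i} := by
  classical
  induction s using Finset.induction_on with
  | empty => simp
  | insert a s ha ih =>
    rw [Finset.prod_insert ha, ← ih fun i hi j hj => hD i (Finset.mem_insert_of_mem hi) j
      (Finset.mem_insert_of_mem hj)]
    have h := measure_inter_of_disjoint (P := P) hz hind (hE a)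
      (F := {l | ∀ i ∈ s, l ∈ E i}) (by
        have : {l | ∀ i ∈ s, l ∈ E i} = ⋂ i ∈ s, E i := by ext; simp
        rw [this]
        exact Finset.measurableSet_biInter s fun i _ => hE i) (hED a)
      (D' := s.biUnion D) (by
        intro l l' hl hlE i hi
        exact hED i l l' (fun v hv => hl v (Finset.mem_biUnion.2 ⟨i, hi, hv⟩)) (hlE i hi)) (by
        rw [Finset.disjoint_biUnion_right]
        intro i hi
        exact hD a (Finset.mem_insert_self _ _) i (Finset.mem_insert_of_mem hi)
          (fun h => ha (h ▸ hi)))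
    refine Eq.trans ?_ h
    congr 1
    ext ω
    simp

end Blocks

/-! ## Message passing on an arbitrary graph of component codes -/

section Generic

variable {ι : Type*}

/-- Messages after `h` half-iterations, if in half-iteration `h + 1` the message on `v` is computed
by a constraint node that has `v` at position `p h v` and `ch h v i` at the other positions `i`. -/
def genMsg (C : LinCode n) (t : ℕ) (ch : ℕ → ι → Fin n → ι) (p : ℕ → ι → Fin n) (μ : ℕ → Lut)
    (l : ι → ℝ) : ℕ → ι → ZMod 2
  | 0, v => hardBit (l v)
  | h + 1, v => cnMsg C t (μ (h + 1)) (fun i => genMsg C t ch p μ l h (ch h v i)) (p h v) (l v)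

/-- The BDD output on `v` in half-iteration `h + 1`. -/
def genBdd (C : LinCode n) (t : ℕ) (ch : ℕ → ι → Fin n → ι) (p : ℕ → ι → Fin n) (μ : ℕ → Lut)
    (l : ι → ℝ) (h : ℕ) (v : ι) : SignType :=
  extBdd C t (fun i => genMsg C t ch p μ l h (ch h v i)) (p h v) (hardBit (l v))

open Classical in
/-- The nodes whose noise variables determine the message on `v` after `h` half-iterations. -/
def depSet (ch : ℕ → ι → Fin n → ι) (p : ℕ → ι → Fin n) : ℕ → ι → Finset ι
  | 0, v => {v}
  | h + 1, v => insert v ((Finset.univ.erase (p h v)).biUnion fun i => depSet ch p h (ch h v i))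

/-- The nodes that determine the message on `v` after `h` half-iterations form a tree. -/
def TreeLike (ch : ℕ → ι → Fin n → ι) (p : ℕ → ι → Fin n) : ℕ → ι → Prop
  | 0, _ => True
  | h + 1, v => (∀ i ≠ p h v, TreeLike ch p h (ch h v i) ∧ v ∉ depSet ch p h (ch h v i)) ∧
      ∀ i ≠ p h v, ∀ j ≠ p h v, i ≠ j →
        Disjoint (depSet ch p h (ch h v i)) (depSet ch p h (ch h v j))

variable (C : LinCode n) (t : ℕ) (ch : ℕ → ι → Fin n → ι) (p : ℕ → ι → Fin n)

/-- Extrinsic decoding overwrites the input at `j`; this is why `depSet` skips the branch at a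
node's own position. -/
theorem extBdd_congr {y y' : Fin n → ZMod 2} {j : Fin n} (r : ZMod 2)
    (h : ∀ i ≠ j, y i = y' i) : extBdd C t y j r = extBdd C t y' j r := by
  unfold extBdd
  congr 1
  ext i
  by_cases hi : i = j
  · subst hi; simp
  · simp [hi, h i hi]

theorem genMsg_congr (μ : ℕ → Lut) {l l' : ι → ℝ} (h : ℕ) (v : ι)
    (hl : ∀ w ∈ depSet ch p h v, l w = l' w) :
    genMsg C t ch p μ l h v = genMsg C t ch p μ l' h v := by
  induction h generalizing v with
  | zero => simp [genMsg, hl v (by simp [depSet])]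
  | succ h ih =>
    unfold genMsg cnMsg
    rw [hl v (by simp [depSet])]
    rw [extBdd_congr C t _ fun i hi => ih (ch h v i) fun w hw => hl w ?_]
    simp only [depSet, Finset.mem_insert, Finset.mem_biUnion]
    exact Or.inr ⟨i, by simp [hi], hw⟩

theorem genMsg_congr_lut {μ μ' : ℕ → Lut} (l : ι → ℝ) (h : ℕ)
    (hμ : ∀ k ≤ h, μ k = μ' k) (v : ι) :
    genMsg C t ch p μ l h v = genMsg C t ch p μ' l h v := by
  induction h generalizing v with
  | zero => rfl
  | succ h ih =>
    have ih' := ih fun k hk => hμ k (by omega)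
    unfold genMsg
    rw [hμ (h + 1) le_rfl]
    simp only [ih']

theorem measurable_genMsg (μ : ℕ → Lut) (h : ℕ) (v : ι) :
    Measurable fun l : ι → ℝ => genMsg C t ch p μ l h v := by
  induction h generalizing v with
  | zero => exact measurable_hardBit.comp (measurable_pi_apply v)
  | succ h ih =>
    have hy : Measurable fun l : ι → ℝ => ((fun i => genMsg C t ch p μ l h (ch h v i)),
        hardBit (l v)) :=
      (measurable_pi_lambda _ fun i => ih (ch h v i)).prodMk
        (measurable_hardBit.comp (measurable_pi_apply v))
    -- The table is looked up from finitely many bits, so only the added LLR is a continuous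
    -- quantity.
    have hF : Measurable fun q : (Fin n → ZMod 2) × ZMod 2 =>
        μ (h + 1) (extBdd C t q.1 (p h v) q.2) (bitSign q.2) := Measurable.of_discrete
    have := measurable_hardBit.comp ((hF.comp hy).add (measurable_pi_apply v))
    convert this using 2 with l
    simp [genMsg, cnMsg, hardSign_eq]

theorem measurableSet_genBdd (μ : ℕ → Lut) (h : ℕ) (v : ι) (u : SignType) :
    MeasurableSet {l : ι → ℝ | genBdd C t ch p μ l h v = u} := by
  have hy : Measurable fun l : ι → ℝ => ((fun i => genMsg C t ch p μ l h (ch h v i)),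
      hardBit (l v)) :=
    (measurable_pi_lambda _ fun i => measurable_genMsg C t ch p μ h (ch h v i)).prodMk
      (measurable_hardBit.comp (measurable_pi_apply v))
  exact hy (MeasurableSet.of_discrete
    (s := {q : (Fin n → ZMod 2) × ZMod 2 | extBdd C t q.1 (p h v) q.2 = u}))

end Generic

theorem measureReal_eq_sum_of_partition {Ω κ : Type*} [MeasurableSpace Ω] (P : Measure Ω)
    [IsFiniteMeasure P] (T : Finset κ) {E : Set Ω} {F : κ → Set Ω}
    (hF : ∀ k ∈ T, MeasurableSet (F k)) (hdisj : ∀ k k' ω, ω ∈ F k → ω ∈ F k' → k = k')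
    (hE : ∀ ω, ω ∈ E ↔ ∃ k ∈ T, ω ∈ F k) : P.real E = ∑ k ∈ T, P.real (F k) := by
  rw [← measureReal_biUnion_finset _ hF]
  · congr 1
    ext ω
    simp [hE]
  · intro k _ k' _ hne
    exact Set.disjoint_left.2 fun ω h h' => hne (hdisj k k' ω h h')

/-! ### Density evolution at a tree-like constraint node -/

section Generic

variable {ι : Type*} (C : LinCode n) (t : ℕ) (ch : ℕ → ι → Fin n → ι) (p : ℕ → ι → Fin n)
  (μ : ℕ → Lut) (σ : ℝ) (w : ι → ZMod 2)

/-- The channel LLRs for the transmitted word `w` under the noise `y`. -/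
def chanLlr (y : ι → ℝ) : ι → ℝ := fun v => llr σ (w v) (y v)

theorem measurable_chanLlr : Measurable (chanLlr σ w) :=
  measurable_pi_lambda _ fun v => (measurable_llr σ (w v)).comp (measurable_pi_apply v)

/-- The positions, other than that of `v`, that bring a wrong message to the constraint node which
processes `v` in half-iteration `h + 1`. -/
def errPos (h : ℕ) (v : ι) (y : ι → ℝ) : Finset (Fin n) :=
  (Finset.univ.erase (p h v)).filter
    fun i => genMsg C t ch p μ (chanLlr σ w y) h (ch h v i) ≠ w (ch h v i)

theorem measurableSet_genMsg_ne (h : ℕ) (v : ι) :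
    MeasurableSet {y : ι → ℝ | genMsg C t ch p μ (chanLlr σ w y) h v ≠ w v} :=
  ((measurable_genMsg C t ch p μ h v).comp (measurable_chanLlr σ w))
    (measurableSet_singleton (w v)).compl

theorem setDependsOn_genMsg_ne (h : ℕ) (v : ι) :
    SetDependsOn {y : ι → ℝ | genMsg C t ch p μ (chanLlr σ w y) h v ≠ w v}
      (depSet ch p h v) := by
  intro l l' hl hE
  simp only [Set.mem_ofPred_eq] at hE ⊢
  rwa [← genMsg_congr C t ch p μ h v (l := chanLlr σ w l)]
  intro v' hv'
  simp [chanLlr, hl v' hv']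

theorem measurableSet_errPos_eq (h : ℕ) (v : ι) (S : Finset (Fin n)) :
    MeasurableSet {y : ι → ℝ | errPos C t ch p μ σ w h v y = S} := by
  have : {y : ι → ℝ | errPos C t ch p μ σ w h v y = S} = ⋂ i : Fin n,
      {y | (i ≠ p h v ∧ genMsg C t ch p μ (chanLlr σ w y) h (ch h v i) ≠ w (ch h v i)) ↔
        i ∈ S} := by
    ext y
    simp [errPos, Finset.ext_iff]
  rw [this]
  refine MeasurableSet.iInter fun i => ?_
  exact ((MeasurableSet.const _).inter (measurableSet_genMsg_ne C t ch p μ σ w h (ch h v i))).iff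
    (MeasurableSet.const _)

variable {C t ch p μ σ w}

/-- The decoder input is the local codeword plus an error word, and `bdd_add` extracts the codeword
as a sign. From here on BDD sees only the error pattern. -/
theorem extBdd_eq_errWord (hC : CorrectsErrors C t) {h : ℕ} {v : ι}
    (hw : (fun i => if i = p h v then w v else w (ch h v i)) ∈ C) (y : ι → ℝ) (r : ZMod 2) :
    extBdd C t (fun i => genMsg C t ch p μ (chanLlr σ w y) h (ch h v i)) (p h v) r =
      bitSign (w v) * bdd C t (errWord (r + w v) (p h v) (errPos C t ch p μ σ w h v y))
        (p h v) := by
  have e2 : ∀ a b : ZMod 2, a + b + b = a := by decide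
  have e3 : ∀ a b : ZMod 2, a ≠ b → a = 1 + b := by decide
  have hadd := bdd_add hC hw
    (errWord (r + w v) (p h v) (errPos C t ch p μ σ w h v y)) (p h v)
  simp only [if_true] at hadd
  rw [← hadd, extBdd]
  congr 1
  ext i
  by_cases hi : i = p h v
  · subst hi
    simp [errWord, e2]
  · rw [Function.update_of_ne hi]
    simp only [Pi.add_apply, errWord, hi, if_false, errPos, Finset.mem_filter, Finset.mem_erase,
      Finset.mem_univ, ne_eq, not_false_eq_true, and_true, true_and]
    split_ifs with hh
    · rw [hh, zero_add]
    · exact e3 _ _ hh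

variable {Ω : Type*} [MeasurableSpace Ω] {P : Measure Ω} [IsProbabilityMeasure P] {z : ι → Ω → ℝ}

/-- Joint law of the root noise and the error pattern at a tree-like constraint node. -/
theorem measureReal_errPos_eq (hz : ∀ v, Measurable (z v)) (hind : iIndepFun z P)
    (hlaw : ∀ v, P.map (z v) = noiseLaw σ) {h : ℕ} {v : ι} (htree : TreeLike ch p (h + 1) v)
    {x : ℝ} (hx : ∀ i ≠ p h v, P.real {ω | genMsg C t ch p μ (chanLlr σ w fun v => z v ω) h
      (ch h v i) ≠ w (ch h v i)} = x) {A : Set ℝ} (hA : MeasurableSet A)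
    {S : Finset (Fin n)} (hS : S ⊆ Finset.univ.erase (p h v)) :
    P.real {ω | z v ω ∈ A ∧ errPos C t ch p μ σ w h v (fun v => z v ω) = S} =
      (noiseLaw σ).real A * (x ^ S.card * (1 - x) ^ (n - 1 - S.card)) := by
  classical
  have hZ : Measurable fun ω v => z v ω := measurable_pi_lambda _ hz
  let G : Fin n → Set (ι → ℝ) := fun i =>
    {y | genMsg C t ch p μ (chanLlr σ w y) h (ch h v i) ≠ w (ch h v i)}
  have hG : ∀ i, MeasurableSet (G i) := fun i => measurableSet_genMsg_ne C t ch p μ σ w h _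
  have hGD : ∀ i, SetDependsOn (G i) (depSet ch p h (ch h v i)) := fun i =>
    setDependsOn_genMsg_ne C t ch p μ σ w h _
  -- The node's own noise event takes the slot `p h v`, so the joint law is one product over all `n`
  -- positions.
  let E : Fin n → Set (ι → ℝ) := fun i =>
    if i = p h v then {y | y v ∈ A} else if i ∈ S then G i else (G i)ᶜ
  let D : Fin n → Finset ι := fun i => if i = p h v then {v} else depSet ch p h (ch h v i)
  have hE : ∀ i, MeasurableSet (E i) := by
    intro i
    simp only [E]
    split_ifs
    · exact (measurable_pi_apply v) hA
    · exact hG i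
    · exact (hG i).compl
  have hED : ∀ i, SetDependsOn (E i) (D i) := by
    intro i
    simp only [E, D]
    split_ifs
    · intro l l' hl hlA
      simpa [← hl v (by simp)] using hlA
    · exact hGD i
    · intro l l' hl hlA hl'
      exact hlA (hGD i l' l (fun v' hv' => (hl v' hv').symm) hl')
  have hD : ∀ i ∈ Finset.univ, ∀ j ∈ Finset.univ, i ≠ j → Disjoint (D i) (D j) := by
    intro i _ j _ hij
    simp only [D]
    split_ifs with hi hj hj
    · exact absurd (hi.trans hj.symm) hij
    · exact Finset.disjoint_singleton_left.2 (htree.1 j hj).2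
    · exact Finset.disjoint_singleton_right.2 (htree.1 i hi).2
    · exact htree.2 i hi j hj hij
  have hprod := measure_iInter_of_pairwiseDisjoint (P := P) hz hind Finset.univ hE hED hD
  have hset : {ω | z v ω ∈ A ∧ errPos C t ch p μ σ w h v (fun v => z v ω) = S} =
      {ω | ∀ i ∈ Finset.univ, (fun v => z v ω) ∈ E i} := by
    ext ω
    simp only [Set.mem_ofPred_eq, Finset.mem_univ, forall_const]
    constructor
    · rintro ⟨h1, h2⟩ i
      simp only [E]
      split_ifs with hi hi'
      · exact h1
      · rw [← h2] at hi'
        exact (Finset.mem_filter.1 hi').2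
      · intro hGi
        exact hi' (h2 ▸ Finset.mem_filter.2 ⟨by simpa using hi, hGi⟩)
    · intro hall
      refine ⟨by simpa [E] using hall (p h v), ?_⟩
      ext i
      have hi := hall i
      simp only [E] at hi
      simp only [errPos, Finset.mem_filter, Finset.mem_erase, Finset.mem_univ, and_true]
      constructor
      · rintro ⟨hip, hne⟩
        by_contra hiS
        rw [if_neg hip, if_neg hiS] at hi
        exact hi hne
      · intro hiS
        have hip := Finset.ne_of_mem_erase (hS hiS)
        rw [if_neg hip, if_pos hiS] at hi
        exact ⟨hip, hi⟩
  have hroot : P.real {ω | (fun v => z v ω) ∈ E (p h v)} = (noiseLaw σ).real A := by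
    rw [← hlaw v, map_measureReal_apply (hz v) hA]
    simp [E, Set.preimage]
  have hother : ∀ i ∈ Finset.univ.erase (p h v), P.real {ω | (fun v => z v ω) ∈ E i} =
      if i ∈ S then x else 1 - x := by
    intro i hi
    have hip := Finset.ne_of_mem_erase hi
    simp only [E, if_neg hip]
    split_ifs
    · exact hx i hip
    · have := probReal_compl_eq_one_sub (μ := P) (hZ (hG i))
      rw [← hx i hip]
      exact this
  rw [hset, measureReal_def, hprod, ENNReal.toReal_prod]
  simp only [← measureReal_def]
  rw [← Finset.mul_prod_erase _ _ (Finset.mem_univ (p h v)), hroot, Finset.prod_congr rfl hother,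
    Finset.prod_ite, Finset.prod_const, Finset.prod_const]
  have hc1 : (Finset.univ.erase (p h v)).filter (· ∈ S) = S := by
    ext i
    simpa using fun hi => Finset.ne_of_mem_erase (hS hi)
  have hc2 : ((Finset.univ.erase (p h v)).filter (· ∉ S)).card = n - 1 - S.card := by
    rw [Finset.filter_notMem_eq_sdiff, Finset.card_sdiff_of_subset hS,
      Finset.card_erase_of_mem (Finset.mem_univ _), Finset.card_univ, Fintype.card_fin]
  rw [hc1, hc2]

/-- Summing the joint law over the error patterns with outcome `u` produces the mixture; the own
noise stays a separate factor. -/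
theorem measureReal_bdd_errWord (hCt : HasTransitiveAut C) (hz : ∀ v, Measurable (z v))
    (hind : iIndepFun z P) (hlaw : ∀ v, P.map (z v) = noiseLaw σ) {h : ℕ} {v : ι}
    (htree : TreeLike ch p (h + 1) v) {x : ℝ}
    (hx : ∀ i ≠ p h v, P.real {ω | genMsg C t ch p μ (chanLlr σ w fun v => z v ω) h
      (ch h v i) ≠ w (ch h v i)} = x) {A : Set ℝ} (hA : MeasurableSet A) (a : ZMod 2)
    (u : SignType) :
    P.real {ω | z v ω ∈ A ∧ bdd C t (errWord a (p h v)
      (errPos C t ch p μ σ w h v fun v => z v ω)) (p h v) = u} =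
      (noiseLaw σ).real A * mix n (outcomeProb C t a u) x := by
  classical
  have hZ : Measurable fun ω v => z v ω := measurable_pi_lambda _ hz
  rw [mix_outcomeProb hCt t a u (p h v), Finset.mul_sum]
  rw [measureReal_eq_sum_of_partition P _ (F := fun S => {ω | z v ω ∈ A ∧
    errPos C t ch p μ σ w h v (fun v => z v ω) = S})]
  · refine Finset.sum_congr rfl fun S hS => ?_
    exact measureReal_errPos_eq hz hind hlaw htree hx hA
      (Finset.mem_powerset.1 (Finset.mem_filter.1 hS).1)
  · intro S _
    exact (hz v hA).inter (hZ (measurableSet_errPos_eq C t ch p μ σ w h v S))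
  · intro S S' ω h1 h2
    exact h1.2.symm.trans h2.2
  · intro ω
    constructor
    · rintro ⟨h1, h2⟩
      refine ⟨_, Finset.mem_filter.2 ⟨Finset.mem_powerset.2 (Finset.filter_subset _ _), h2⟩, h1,
        rfl⟩
    · rintro ⟨S, hS, h1, h2⟩
      refine ⟨h1, ?_⟩
      rw [h2]
      exact (Finset.mem_filter.1 hS).2

/-- Joint law of the channel hard decision and the BDD output on a tree-like node. -/
theorem measureReal_genBdd (hC : CorrectsErrors C t) (hCt : HasTransitiveAut C)
    (hz : ∀ v, Measurable (z v)) (hind : iIndepFun z P) (hlaw : ∀ v, P.map (z v) = noiseLaw σ)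
    {h : ℕ} {v : ι} (hw : (fun i => if i = p h v then w v else w (ch h v i)) ∈ C)
    (htree : TreeLike ch p (h + 1) v) {x : ℝ}
    (hx : ∀ i ≠ p h v, P.real {ω | genMsg C t ch p μ (chanLlr σ w fun v => z v ω) h
      (ch h v i) ≠ w (ch h v i)} = x) (r : ZMod 2) (u : SignType) :
    P.real {ω | hardBit (llr σ (w v) (z v ω)) = r ∧
      genBdd C t ch p μ (chanLlr σ w fun v => z v ω) h v = u} =
      (noiseLaw σ).real {y | hardBit (llr σ (w v) y) = r} *
        mix n (outcomeProb C t (r + w v) (bitSign (w v) * u)) x := by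
  have e : ∀ (b : ZMod 2) (u u' : SignType), bitSign b * u = u' ↔ u = bitSign b * u' := by decide
  refine Eq.trans ?_ (measureReal_bdd_errWord hCt hz hind hlaw htree hx
    ((measurable_hardBit.comp (measurable_llr σ (w v))) (measurableSet_singleton r)) _ _)
  congr 1
  ext ω
  simp only [Set.mem_ofPred_eq, genBdd, extBdd_eq_errWord hC hw, e]
  refine and_congr_right fun h1 => ?_
  rw [show chanLlr σ w (fun v => z v ω) v = llr σ (w v) (z v ω) from rfl, h1]

/-- Density evolution at a tree-like node, for arbitrary correction terms with the antipodal
symmetry. -/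
theorem measureReal_genMsg_succ (hC : CorrectsErrors C t) (hCt : HasTransitiveAut C) (hσ : 0 < σ)
    (hz : ∀ v, Measurable (z v)) (hind : iIndepFun z P) (hlaw : ∀ v, P.map (z v) = noiseLaw σ)
    {h : ℕ} {v : ι} (hw : (fun i => if i = p h v then w v else w (ch h v i)) ∈ C)
    (hμ : OddLut (μ (h + 1))) (htree : TreeLike ch p (h + 1) v) {x : ℝ}
    (hx : ∀ i ≠ p h v, P.real {ω | genMsg C t ch p μ (chanLlr σ w fun v => z v ω) h
      (ch h v i) ≠ w (ch h v i)} = x) :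
    P.real {ω | genMsg C t ch p μ (chanLlr σ w fun v => z v ω) (h + 1) v ≠ w v} =
      oneStep C t σ (μ (h + 1)) x := by
  classical
  have hZ : Measurable fun ω v => z v ω := measurable_pi_lambda _ hz
  have e1 : ∀ a b : ZMod 2, a ≠ b ↔ a = b + 1 := by decide
  have hflip : ∀ a u, (noiseLaw σ).real (errSet σ (w v) a
      (μ (h + 1) (bitSign (w v) * u) (bitSign (w v + a)))) =
      (noiseLaw σ).real (errSet σ 0 a (μ (h + 1) u (bitSign a))) := by
    intro a u
    rcases zmod2_cases (w v) with hb | hb <;> rw [hb]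
    · simp
    · rw [bitSign_one, neg_one_mul, add_comm 1 a, hμ u a, noiseLaw_errSet_flip hσ]
  unfold oneStep
  rw [← Finset.sum_product']
  rw [measureReal_eq_sum_of_partition P (Finset.univ ×ˢ Finset.univ)
    (F := fun k : SignType × ZMod 2 => {ω |
      z v ω ∈ errSet σ (w v) k.2 (μ (h + 1) (bitSign (w v) * k.1) (bitSign (w v + k.2))) ∧
      bdd C t (errWord k.2 (p h v) (errPos C t ch p μ σ w h v fun v => z v ω)) (p h v) = k.1})]
  · refine Finset.sum_congr rfl fun k _ => ?_
    rw [measureReal_bdd_errWord hCt hz hind hlaw htree hx (measurableSet_errSet _ _ _ _), hflip]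
  · rintro ⟨u, a⟩ -
    refine (hz v (measurableSet_errSet _ _ _ _)).inter ?_
    have : {ω | bdd C t (errWord a (p h v) (errPos C t ch p μ σ w h v fun v => z v ω)) (p h v)
        = u} = ⋃ S : Finset (Fin n), ⋃ _ : bdd C t (errWord a (p h v) S) (p h v) = u,
          {ω | errPos C t ch p μ σ w h v (fun v => z v ω) = S} := by
      ext ω; simp
    change MeasurableSet {ω | bdd C t (errWord a (p h v)
      (errPos C t ch p μ σ w h v fun v => z v ω)) (p h v) = u}
    rw [this]
    exact MeasurableSet.iUnion fun S => MeasurableSet.iUnion fun _ =>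
      hZ (measurableSet_errPos_eq C t ch p μ σ w h v S)
  · rintro ⟨u, a⟩ ⟨u', a'⟩ ω ⟨⟨h1, _⟩, h2⟩ ⟨⟨h3, _⟩, h4⟩
    have ha : a = a' := add_left_cancel (h1.symm.trans h3)
    subst ha
    exact Prod.ext (h2.symm.trans h4) rfl
  · intro ω
    simp only [Set.mem_ofPred_eq, Finset.mem_product, Finset.mem_univ, and_self, true_and,
      Prod.exists, errSet]
    rw [genMsg, cnMsg, extBdd_eq_errWord hC hw, e1, hardSign_eq]
    rw [show chanLlr σ w (fun v => z v ω) v = llr σ (w v) (z v ω) from rfl]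
    constructor
    · intro hm
      refine ⟨_, w v + hardBit (llr σ (w v) (z v ω)), ⟨?_, ?_⟩, rfl⟩
      · rw [← add_assoc, CharTwo.add_self_eq_zero, zero_add]
      · rw [← add_assoc, CharTwo.add_self_eq_zero, zero_add, add_comm (w v) (hardBit _)]
        exact hm
    · rintro ⟨u, a, ⟨h1, h2⟩, h3⟩
      rw [h1, add_comm (w v) a, add_assoc, CharTwo.add_self_eq_zero, add_zero, h3, add_comm a]
      exact h2

/-- The density evolution sequence for the correction terms `μ`. -/
def deSeq (C : LinCode n) (t : ℕ) (σ : ℝ) (μ : ℕ → Lut) : ℕ → ℝ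
  | 0 => gaussQ (1 / σ)
  | h + 1 => oneStep C t σ (μ (h + 1)) (deSeq C t σ μ h)

/-- The value depends neither on `w` nor on `v`, so all incoming messages share one error
probability and the induction closes. The base case is an uncorrected hard decision, i.e. `errSet`
with correction term `0`. -/
theorem measureReal_genMsg (hC : CorrectsErrors C t) (hCt : HasTransitiveAut C) (hσ : 0 < σ)
    (hz : ∀ v, Measurable (z v)) (hind : iIndepFun z P) (hlaw : ∀ v, P.map (z v) = noiseLaw σ)
    (hw : ∀ h v, (fun i => if i = p h v then w v else w (ch h v i)) ∈ C) (h : ℕ)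
    (hμ : ∀ k ≤ h, OddLut (μ k)) (v : ι) (htree : TreeLike ch p h v) :
    P.real {ω | genMsg C t ch p μ (chanLlr σ w fun v => z v ω) h v ≠ w v} =
      deSeq C t σ μ h := by
  induction h generalizing v with
  | zero =>
    have h0 := noiseLaw_errSet_one hσ 0
    have h1 : (noiseLaw σ).real (errSet σ (w v) 1 0) = gaussQ (1 / σ) := by
      rcases zmod2_cases (w v) with hb | hb <;> rw [hb]
      · simpa using h0
      · have := noiseLaw_errSet_flip hσ 1 0
        rw [neg_zero] at this
        rw [this]; simpa using h0
    have e1 : ∀ a b : ZMod 2, a ≠ b ↔ a = b + 1 := by decide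
    rw [deSeq, ← h1, ← hlaw v, map_measureReal_apply (hz v) (measurableSet_errSet _ _ _ _)]
    congr 1
    ext ω
    simp [genMsg, errSet, chanLlr, e1]
  | succ h ih =>
    exact measureReal_genMsg_succ hC hCt hσ hz hind hlaw (hw h v) (hμ (h + 1) le_rfl) htree
      fun i hi => ih (fun k hk => hμ k (by omega)) _ (htree.1 i hi).1

end Generic

/-! ## The computation tree -/

/-- Lebesgue measure is absolutely continuous with respect to the noise law, and each hard decision
occurs on a half-line. This makes conditioning on the channel sign legitimate. -/
theorem noiseLaw_hardBit_ne_zero {σ : ℝ} (hσ : 0 < σ) (b r : ZMod 2) :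
    (noiseLaw σ).real {y | hardBit (llr σ b y) = r} ≠ 0 := by
  have hac : volume ≪ noiseLaw σ := gaussianReal_absolutelyContinuous' 0 (by simpa using hσ.ne')
  have h2 : (0 : ℝ) < 2 / σ ^ 2 := by positivity
  intro h0
  rw [measureReal_def, ENNReal.toReal_eq_zero_iff] at h0
  have h0 := hac (h0.resolve_right (measure_ne_top _ _))
  rcases zmod2_cases r with rfl | rfl
  · have hsub : Set.Ioi (-bpsk b) ⊆ {y | hardBit (llr σ b y) = 0} := by
      intro y hy
      rw [Set.mem_Ioi] at hy
      rw [Set.mem_ofPred_eq, hardBit_eq_zero]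
      exact mul_nonneg h2.le (by linarith)
    have := measure_mono_null hsub h0
    simp at this
  · have hsub : Set.Iio (-bpsk b) ⊆ {y | hardBit (llr σ b y) = 1} := by
      intro y hy
      rw [Set.mem_Iio] at hy
      rw [Set.mem_ofPred_eq, hardBit_eq_one]
      exact mul_neg_of_pos_of_neg h2 (by linarith)
    have := measure_mono_null hsub h0
    simp at this

/-- Conditioning on one of two independent random elements. -/
theorem measureReal_of_indepFun {Ω α β : Type*} [MeasurableSpace Ω] [MeasurableSpace α]
    [MeasurableSpace β] {P : Measure Ω} [IsProbabilityMeasure P] {c : Ω → α} {z : Ω → β}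
    (hc : Measurable c) (hz : Measurable z) (hcz : IndepFun c z P) {E : Set (α × β)}
    (hE : MeasurableSet E) {B : Set Ω} (hB : MeasurableSet B) {κ : ℝ}
    (h1 : ∀ ω ∈ B, P.real {ω' | (c ω, z ω') ∈ E} = κ) (h0 : ∀ ω ∉ B, ∀ ω', (c ω, z ω') ∉ E) :
    P.real {ω | (c ω, z ω) ∈ E} = P.real B * κ := by
  -- If `B` is empty, `κ` is unconstrained; otherwise a point of `B` exhibits `κ` as a probability,
  -- so `ENNReal.ofReal κ` loses nothing.
  by_cases hBe : B = ∅
  · subst hBe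
    have : {ω | (c ω, z ω) ∈ E} = ∅ := by
      ext ω; simpa using h0 ω (by simp) ω
    simp [this]
  obtain ⟨ω₀, hω₀⟩ := Set.nonempty_iff_ne_empty.2 hBe
  have hmap := (indepFun_iff_map_prod_eq_prod_map_map hc.aemeasurable hz.aemeasurable).1 hcz
  have hP : P {ω | (c ω, z ω) ∈ E} = ∫⁻ ω, P {ω' | (c ω, z ω') ∈ E} ∂P := by
    have : P {ω | (c ω, z ω) ∈ E} = P.map (fun ω => (c ω, z ω)) E := by
      rw [Measure.map_apply (hc.prodMk hz) hE]; rfl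
    have : IsProbabilityMeasure (P.map z) := Measure.isProbabilityMeasure_map hz.aemeasurable
    rw [‹P {ω | (c ω, z ω) ∈ E} = _›, hmap, Measure.prod_apply hE,
      lintegral_map (measurable_measure_prodMk_left hE) hc]
    refine lintegral_congr fun ω => ?_
    rw [Measure.map_apply hz (measurable_prodMk_left hE)]
    rfl
  have hκ : ∀ ω, P {ω' | (c ω, z ω') ∈ E} = B.indicator (fun _ => ENNReal.ofReal κ) ω := by
    intro ω
    by_cases hω : ω ∈ B
    · rw [Set.indicator_of_mem hω, ← h1 ω hω, measureReal_def,
        ENNReal.ofReal_toReal (measure_ne_top _ _)]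
    · rw [Set.indicator_of_notMem hω]
      have : {ω' | (c ω, z ω') ∈ E} = ∅ := by
        ext ω'; simpa using h0 ω hω ω'
      rw [this, measure_empty]
  have hκ0 : 0 ≤ κ := by rw [← h1 ω₀ hω₀]; exact measureReal_nonneg
  rw [measureReal_def, hP, lintegral_congr hκ, lintegral_indicator hB, lintegral_const,
    Measure.restrict_apply_univ, ENNReal.toReal_mul, ENNReal.toReal_ofReal hκ0, mul_comm]
  rfl

section Tree

variable (C : LinCode n) (t : ℕ) (pos : List (Fin n) → Fin n)

/-- The children of a node of the computation tree. -/
def treeChild (_ : ℕ) (v : List (Fin n)) (i : Fin n) : List (Fin n) := i :: v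

theorem treeMsg_eq_genMsg (μ : ℕ → Lut) (l : List (Fin n) → ℝ) (h : ℕ) (v : List (Fin n)) :
    treeMsg C t pos μ l h v = genMsg C t treeChild (fun _ => pos) μ l h v := by
  induction h generalizing v with
  | zero => rfl
  | succ h ih => simp only [treeMsg, genMsg, ih]; rfl

theorem treeBdd_eq_genBdd (μ : ℕ → Lut) (l : List (Fin n) → ℝ) (h : ℕ) :
    treeBdd C t pos μ l h = genBdd C t treeChild (fun _ => pos) μ l h [] := by
  simp only [treeBdd, genBdd, treeMsg_eq_genMsg]; rfl

theorem suffix_of_mem_depSet {h : ℕ} {v u : List (Fin n)}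
    (hu : u ∈ depSet treeChild (fun _ => pos) h v) : v <:+ u := by
  induction h generalizing v with
  | zero => simp [depSet] at hu; simp [hu]
  | succ h ih =>
    simp only [depSet, Finset.mem_insert, Finset.mem_biUnion] at hu
    rcases hu with rfl | ⟨i, _, hu⟩
    · exact List.suffix_rfl
    · exact (List.suffix_cons i v).trans (ih hu)

/-- Every descendant's address has its ancestor's address as a suffix. Suffixes of equal length
coincide, which separates siblings, and a parent's address is too short to lie below its child. -/
theorem treeLike_tree (h : ℕ) (v : List (Fin n)) :
    TreeLike treeChild (fun _ => pos) h v := by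
  induction h generalizing v with
  | zero => trivial
  | succ h ih =>
    refine ⟨fun i _ => ⟨ih _, fun hv => ?_⟩, fun i _ j _ hij => Finset.disjoint_left.2 fun u h1 h2 => ?_⟩
    · have := (suffix_of_mem_depSet pos hv).length_le
      simp [treeChild] at this
    · have h1 := suffix_of_mem_depSet pos h1
      have h2 := suffix_of_mem_depSet pos h2
      have := (List.suffix_of_suffix_length_le h1 h2 (by simp [treeChild])).eq_of_length
        (by simp [treeChild])
      exact hij (List.cons.inj this).1

variable {Ω : Type*} [MeasurableSpace Ω] (P : Measure Ω) (σ : ℝ)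
  (c : Ω → List (Fin n) → ZMod 2) (z : Ω → List (Fin n) → ℝ)

theorem muUpTo_eq_muTilde {h k : ℕ} (hk : k ≤ h) :
    muUpTo P C t σ pos c z h k = muTilde P C t σ pos c z k := by
  induction h with
  | zero => rw [Nat.le_zero.1 hk]; rfl
  | succ h ih =>
    rcases Nat.lt_or_ge h k with hlt | hle
    · rw [show k = h + 1 by omega]; rfl
    · rw [muUpTo, Function.update_of_ne (by omega), ih hle]

/-- The BDD output of half-iteration `h + 1` uses tables up to `h` only, where the auxiliary
recursion has already stabilised; the recursion thus becomes an equation for `muTilde` alone. -/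
theorem muTilde_succ (h : ℕ) (u s : SignType) :
    muTilde P C t σ pos c z (h + 1) u s =
      Real.log (condBdd P C t σ pos c z (muTilde P C t σ pos c z) h u s 0
        / condBdd P C t σ pos c z (muTilde P C t σ pos c z) h u s 1) := by
  have hbdd : ∀ l, treeBdd C t pos (muUpTo P C t σ pos c z h) l h =
      treeBdd C t pos (muTilde P C t σ pos c z) l h := by
    intro l
    simp only [treeBdd, treeMsg_eq_genMsg]
    congr 1
    ext i
    rw [genMsg_congr_lut C t treeChild _ l h fun k hk => muUpTo_eq_muTilde C t pos P σ c z hk]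
  have hcond : ∀ b, condBdd P C t σ pos c z (muUpTo P C t σ pos c z h) h u s b =
      condBdd P C t σ pos c z (muTilde P C t σ pos c z) h u s b := by
    intro b
    simp only [condBdd, hbdd]
  rw [← hcond, ← hcond, muTilde, muUpTo, Function.update_self]

variable {C t pos P σ c z}

theorem measurable_jointLlr :
    Measurable fun q : (List (Fin n) → ZMod 2) × (List (Fin n) → ℝ) => chanLlr σ q.1 q.2 := by
  refine measurable_pi_lambda _ fun v => ?_
  have : Measurable bpsk := Measurable.of_discrete
  unfold chanLlr llr
  fun_prop

/-- Given the codeword, the error probability is always the same number, so averaging over the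
codeword changes nothing. -/
theorem msgErr_eq_deSeq [IsProbabilityMeasure P] (hC : CorrectsErrors C t)
    (hCt : HasTransitiveAut C) (hσ : 0 < σ) (hc : Measurable c)
    (hcode : ∀ ω, IsTreeCodeword C pos (c ω)) (hz : Measurable z)
    (hlaw : ∀ v, P.map (fun ω => z ω v) = noiseLaw σ)
    (hindep : iIndepFun (fun v ω => z ω v) P) (hcz : IndepFun c z P) {h : ℕ}
    (hμ : ∀ k ≤ h, OddLut (muTilde P C t σ pos c z k)) :
    msgErr P C t σ pos c z h = deSeq C t σ (muTilde P C t σ pos c z) h := by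
  set μ := muTilde P C t σ pos c z with hμdef
  have hE : MeasurableSet {q : (List (Fin n) → ZMod 2) × (List (Fin n) → ℝ) |
      genMsg C t treeChild (fun _ => pos) μ (chanLlr σ q.1 q.2) h [] ≠ q.1 []} := by
    refine (measurableSet_eq_fun ?_ ?_).compl
    · exact (measurable_genMsg C t treeChild _ μ h []).comp measurable_jointLlr
    · fun_prop
  have := measureReal_of_indepFun (P := P) hc hz hcz hE MeasurableSet.univ
    (κ := deSeq C t σ μ h) (fun ω _ =>
      measureReal_genMsg (z := fun v ω => z ω v) hC hCt hσ (fun v => (measurable_pi_apply v).comp hz)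
        hindep hlaw (fun _ => hcode ω) h hμ [] (treeLike_tree pos h [])) (by simp)
  rw [probReal_univ, one_mul] at this
  rw [← this, msgErr]
  simp only [treeMsg_eq_genMsg]
  rfl

/-- Both the joint and the conditioning event carry the factors for the root bit and for its hard
decision. They are nonzero and cancel, leaving the mixture. -/
theorem condBdd_eq_mix [IsProbabilityMeasure P] (hC : CorrectsErrors C t)
    (hCt : HasTransitiveAut C) (hσ : 0 < σ) (hc : Measurable c)
    (hcode : ∀ ω, IsTreeCodeword C pos (c ω)) (hbit : ∀ b, P {ω | c ω [] = b} ≠ 0)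
    (hz : Measurable z) (hlaw : ∀ v, P.map (fun ω => z ω v) = noiseLaw σ)
    (hindep : iIndepFun (fun v ω => z ω v) P) (hcz : IndepFun c z P) {h : ℕ}
    (hμ : ∀ k ≤ h, OddLut (muTilde P C t σ pos c z k)) (u : SignType) (r b : ZMod 2) :
    condBdd P C t σ pos c z (muTilde P C t σ pos c z) h u (bitSign r) b =
      mix n (outcomeProb C t (r + b) (bitSign b * u))
        (deSeq C t σ (muTilde P C t σ pos c z) h) := by
  set μ := muTilde P C t σ pos c z with hμdef
  have hzv : ∀ v, Measurable fun ω => z ω v := fun v => (measurable_pi_apply v).comp hz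
  have hB : MeasurableSet {ω | c ω [] = b} :=
    ((measurable_pi_apply []).comp hc) (measurableSet_singleton b)
  have hroot : Measurable fun q : (List (Fin n) → ZMod 2) × (List (Fin n) → ℝ) =>
      hardBit (chanLlr σ q.1 q.2 []) :=
    measurable_hardBit.comp ((measurable_pi_apply []).comp measurable_jointLlr)
  have hbdd : MeasurableSet {q : (List (Fin n) → ZMod 2) × (List (Fin n) → ℝ) |
      genBdd C t treeChild (fun _ => pos) μ (chanLlr σ q.1 q.2) h [] = u} :=
    measurable_jointLlr (measurableSet_genBdd C t treeChild _ μ h [] u)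
  have hbit' : Measurable fun q : (List (Fin n) → ZMod 2) × (List (Fin n) → ℝ) => q.1 [] :=
    (measurable_pi_apply []).comp measurable_fst
  have hS : MeasurableSet {q : (List (Fin n) → ZMod 2) × (List (Fin n) → ℝ) |
      hardBit (chanLlr σ q.1 q.2 []) = r ∧ q.1 [] = b} :=
    (hroot (measurableSet_singleton r)).inter
      (hbit' (measurableSet_singleton b))
  have e1 := measureReal_of_indepFun (P := P) hc hz hcz hS hB
    (κ := (noiseLaw σ).real {y | hardBit (llr σ b y) = r}) (by
      intro ω hω
      rw [← hlaw []]
      refine Eq.trans ?_ (map_measureReal_apply (hzv [])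
        ((measurable_hardBit.comp (measurable_llr σ b)) (measurableSet_singleton r))).symm
      congr 1
      ext ω'
      have hω : c ω [] = b := hω
      simp [chanLlr, hω]) (fun ω hω ω' hh => hω hh.2)
  have e2 := measureReal_of_indepFun (P := P) hc hz hcz (hS.inter hbdd) hB
    (κ := (noiseLaw σ).real {y | hardBit (llr σ b y) = r} *
      mix n (outcomeProb C t (r + b) (bitSign b * u)) (deSeq C t σ μ h)) (by
      intro ω hω
      have hω : c ω [] = b := hω
      have key := measureReal_genBdd (z := fun v ω => z ω v) (w := c ω) (v := []) hC hCt hzv hindep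
        hlaw (hcode ω []) (treeLike_tree pos (h + 1) []) (h := h) (μ := μ) (fun i _ =>
          measureReal_genMsg (z := fun v ω => z ω v) hC hCt hσ hzv hindep hlaw (fun _ => hcode ω)
            h hμ _ (treeLike_tree pos h _)) r u
      rw [hω] at key
      rw [← key]
      congr 1
      ext ω'
      simp only [chanLlr, hω, Set.mem_inter_iff, Set.mem_ofPred_eq, and_true])
      (fun ω hω ω' hh => hω hh.1.2)
  have hPB : P.real {ω | c ω [] = b} ≠ 0 := by
    rw [measureReal_def, Ne, ENNReal.toReal_eq_zero_iff]
    exact fun hh => hh.elim (hbit b) (measure_ne_top _ _)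
  have hcondset : {ω | hardSign (treeLlr σ c z ω []) = bitSign r ∧ c ω [] = b} =
      {ω | (c ω, z ω) ∈ {q : (List (Fin n) → ZMod 2) × (List (Fin n) → ℝ) |
        hardBit (chanLlr σ q.1 q.2 []) = r ∧ q.1 [] = b}} := by
    ext ω
    simp only [Set.mem_ofPred_eq, hardSign_eq, bitSign_injective.eq_iff]
    rfl
  have hS' : MeasurableSet {ω | (c ω, z ω) ∈ {q : (List (Fin n) → ZMod 2) × (List (Fin n) → ℝ) |
        hardBit (chanLlr σ q.1 q.2 []) = r ∧ q.1 [] = b}} := (hc.prodMk hz) hS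
  rw [condBdd, hcondset, measureReal_def, cond_apply hS', ENNReal.toReal_mul, ENNReal.toReal_inv,
    ← measureReal_def, ← measureReal_def]
  have hint : P.real ({ω | (c ω, z ω) ∈ {q : (List (Fin n) → ZMod 2) × (List (Fin n) → ℝ) |
        hardBit (chanLlr σ q.1 q.2 []) = r ∧ q.1 [] = b}} ∩
      {ω | treeBdd C t pos μ (treeLlr σ c z ω) h = u}) = P.real {ω | c ω [] = b} *
      ((noiseLaw σ).real {y | hardBit (llr σ b y) = r} *
        mix n (outcomeProb C t (r + b) (bitSign b * u)) (deSeq C t σ μ h)) := by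
    simp only [treeBdd_eq_genBdd]
    exact e2
  refine (congrArg₂ (fun x y => x⁻¹ * y) e1 hint).trans ?_
  have := noiseLaw_hardBit_ne_zero hσ b r
  field_simp

theorem optLut_muTilde_succ [IsProbabilityMeasure P] (hC : CorrectsErrors C t)
    (hCt : HasTransitiveAut C) (hσ : 0 < σ) (hc : Measurable c)
    (hcode : ∀ ω, IsTreeCodeword C pos (c ω)) (hbit : ∀ b, P {ω | c ω [] = b} ≠ 0)
    (hz : Measurable z) (hlaw : ∀ v, P.map (fun ω => z ω v) = noiseLaw σ)
    (hindep : iIndepFun (fun v ω => z ω v) P) (hcz : IndepFun c z P) {h : ℕ}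
    (hμ : ∀ k ≤ h, OddLut (muTilde P C t σ pos c z k)) :
    optLut C t (deSeq C t σ (muTilde P C t σ pos c z) h) (muTilde P C t σ pos c z (h + 1)) := by
  have key : ∀ (u : SignType) (r : ZMod 2), muTilde P C t σ pos c z (h + 1) u (bitSign r) =
      Real.log (mix n (outcomeProb C t r u) (deSeq C t σ (muTilde P C t σ pos c z) h) /
        mix n (outcomeProb C t (r + 1) (-u)) (deSeq C t σ (muTilde P C t σ pos c z) h)) := by
    intro u r
    rw [muTilde_succ,
      condBdd_eq_mix hC hCt hσ hc hcode hbit hz hlaw hindep hcz hμ,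
      condBdd_eq_mix hC hCt hσ hc hcode hbit hz hlaw hindep hcz hμ]
    simp
  exact ⟨key (-1) 1, key 1 1, key 0 1, key (-1) 0, key 1 0, key 0 0⟩

/-- The closed form of a table requires oddness of the earlier ones and implies its own. The table
with index `0` is zero and never consulted. -/
theorem oddLut_muTilde [IsProbabilityMeasure P] (hC : CorrectsErrors C t)
    (hCt : HasTransitiveAut C) (hσ : 0 < σ) (hc : Measurable c)
    (hcode : ∀ ω, IsTreeCodeword C pos (c ω)) (hbit : ∀ b, P {ω | c ω [] = b} ≠ 0)
    (hz : Measurable z) (hlaw : ∀ v, P.map (fun ω => z ω v) = noiseLaw σ)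
    (hindep : iIndepFun (fun v ω => z ω v) P) (hcz : IndepFun c z P) (h : ℕ) :
    OddLut (muTilde P C t σ pos c z h) := by
  induction h using Nat.strong_induction_on with
  | _ h ih =>
    cases h with
    | zero => intro u a; simp [muTilde, muUpTo]
    | succ h => exact (optLut_muTilde_succ hC hCt hσ hc hcode hbit hz hlaw hindep hcz
        fun k hk => ih k (by omega)).odd

end Tree

/-! ## Neighbourhoods in random graphs

Variable nodes are partitioned in two ways, by `f ↦ (ρ s f).1` for `s : Bool`; the classes are the
constraint nodes of type `s`. -/

section Graph

open Classical

variable {M : ℕ}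

/-- The variable nodes reached from `e` by `k` non-backtracking steps, the step number `j` being
through a constraint node of type `T j`. -/
def sphere (ρ : Bool → Equiv.Perm (Fin M × Fin n)) (T : ℕ → Bool) :
    ℕ → Fin M × Fin n → Finset (Fin M × Fin n)
  | 0, e => {e}
  | k + 1, e => Finset.univ.filter
      fun f => ∃ g ∈ sphere ρ T k e, f ≠ g ∧ (ρ (T k) f).1 = (ρ (T k) g).1

/-- The variable nodes reached from `e` by at most `k` steps. -/
def ball (ρ : Bool → Equiv.Perm (Fin M × Fin n)) (T : ℕ → Bool) (k : ℕ) (e : Fin M × Fin n) :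
    Finset (Fin M × Fin n) :=
  (Finset.range (k + 1)).biUnion fun j => sphere ρ T j e

/-- No node at distance `k` shares its constraint node of type `T k` with another node at distance
at most `k`. -/
def Clean (ρ : Bool → Equiv.Perm (Fin M × Fin n)) (T : ℕ → Bool) (k : ℕ) (e : Fin M × Fin n) :
    Prop :=
  ∀ f ∈ sphere ρ T k e, ∀ g ∈ ball ρ T k e, f ≠ g → (ρ (T k) f).1 ≠ (ρ (T k) g).1

variable {ρ : Bool → Equiv.Perm (Fin M × Fin n)} {T : ℕ → Bool} {e : Fin M × Fin n}

theorem mem_sphere_zero {f : Fin M × Fin n} : f ∈ sphere ρ T 0 e ↔ f = e := by simp [sphere]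

theorem mem_sphere_succ {k : ℕ} {f : Fin M × Fin n} : f ∈ sphere ρ T (k + 1) e ↔
    ∃ g ∈ sphere ρ T k e, f ≠ g ∧ (ρ (T k) f).1 = (ρ (T k) g).1 := by simp [sphere]

theorem mem_ball {k : ℕ} {f : Fin M × Fin n} :
    f ∈ ball ρ T k e ↔ ∃ j ≤ k, f ∈ sphere ρ T j e := by simp [ball]

theorem card_filter_fst_eq (τ : Equiv.Perm (Fin M × Fin n)) (a : Fin M) :
    (Finset.univ.filter fun x => (τ x).1 = a).card = n := by
  have : (Finset.univ.filter fun x => (τ x).1 = a).card = (Finset.univ : Finset (Fin n)).card := by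
    refine Finset.card_bij (fun x _ => (τ x).2) (by simp) ?_ ?_
    · intro x hx y hy h
      simp only [Finset.mem_filter, Finset.mem_univ, true_and] at hx hy
      exact τ.injective (Prod.ext (hx.trans hy.symm) h)
    · intro i _
      exact ⟨τ.symm (a, i), by simp, by simp⟩
  simpa using this

theorem card_sphere_le (k : ℕ) : (sphere ρ T k e).card ≤ n ^ k := by
  induction k with
  | zero => simp [sphere]
  | succ k ih =>
    have hsub : sphere ρ T (k + 1) e ⊆ (sphere ρ T k e).biUnion fun g =>
        Finset.univ.filter fun f => (ρ (T k) f).1 = (ρ (T k) g).1 := by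
      intro f hf
      obtain ⟨g, hg, _, h⟩ := mem_sphere_succ.1 hf
      exact Finset.mem_biUnion.2 ⟨g, hg, by simpa using h⟩
    calc _ ≤ _ := Finset.card_le_card hsub
      _ ≤ (sphere ρ T k e).card * n := Finset.card_biUnion_le_card_mul _ _ _
          fun g _ => (card_filter_fst_eq _ _).le
      _ ≤ _ := by rw [pow_succ]; exact Nat.mul_le_mul_right _ ih

/-- Bound on the size of balls of radius `k`. -/
def ballBound (n k : ℕ) : ℕ := ∑ j ∈ Finset.range (k + 1), n ^ j

theorem card_ball_le (k : ℕ) : (ball ρ T k e).card ≤ ballBound n k :=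
  Finset.card_biUnion_le.trans (Finset.sum_le_sum fun j _ => card_sphere_le j)

/-- A node at distance `k` shares a constraint node with one at distance `k - 1`; were it also
nearer to `e`, this would be a collision at distance `k - 1`. -/
theorem notMem_sphere_of_lt {k j : ℕ} (hclean : ∀ i < k, Clean ρ T i e) (hj : j < k)
    {f : Fin M × Fin n} (hf : f ∈ sphere ρ T k e) : f ∉ sphere ρ T j e := by
  obtain ⟨k, rfl⟩ : ∃ k', k = k' + 1 := ⟨k - 1, by omega⟩
  intro hfj
  obtain ⟨g, hg, hne, h⟩ := mem_sphere_succ.1 hf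
  exact hclean k (by omega) g hg f (mem_ball.2 ⟨j, by omega, hfj⟩) hne.symm h.symm

/-! ### Tree-like neighbourhoods -/

theorem mem_sphere_of_child {c : Fin M × Fin n} (hc : c ≠ e)
    (hce : (ρ (T 0) c).1 = (ρ (T 0) e).1) {k : ℕ} {f : Fin M × Fin n}
    (hf : f ∈ sphere ρ (fun j => T (j + 1)) k c) : f ∈ sphere ρ T (k + 1) e := by
  induction k generalizing f with
  | zero =>
    rw [mem_sphere_zero] at hf
    subst hf
    exact mem_sphere_succ.2 ⟨e, mem_sphere_zero.2 rfl, hc, hce⟩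
  | succ k ih =>
    obtain ⟨g, hg, hne, h⟩ := mem_sphere_succ.1 hf
    exact mem_sphere_succ.2 ⟨g, ih hg, hne, h⟩

theorem Clean.child {c : Fin M × Fin n} (hc : c ≠ e)
    (hce : (ρ (T 0) c).1 = (ρ (T 0) e).1) {k : ℕ} (h : Clean ρ T (k + 1) e) :
    Clean ρ (fun j => T (j + 1)) k c := by
  intro f hf g hg hne
  obtain ⟨j, hj, hgj⟩ := mem_ball.1 hg
  exact h f (mem_sphere_of_child hc hce hf) g
    (mem_ball.2 ⟨j + 1, by omega, mem_sphere_of_child hc hce hgj⟩) hne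

/-- If two sibling branches met in `f`, the predecessors of `f` would be distinct by induction and
share a constraint node, a collision as seen from `e`. -/
theorem notMem_sphere_sibling {c c' : Fin M × Fin n} (hc : c ≠ e)
    (hce : (ρ (T 0) c).1 = (ρ (T 0) e).1) (hc' : c' ≠ e)
    (hce' : (ρ (T 0) c').1 = (ρ (T 0) e).1) (hcc : c ≠ c') {k : ℕ}
    (hclean : ∀ i ≤ k, Clean ρ T i e) {f : Fin M × Fin n}
    (hf : f ∈ sphere ρ (fun j => T (j + 1)) k c) :
    f ∉ sphere ρ (fun j => T (j + 1)) k c' := by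
  induction k generalizing f with
  | zero =>
    rw [mem_sphere_zero] at hf ⊢
    exact fun h => hcc (hf.symm.trans h)
  | succ k ih =>
    intro hf'
    obtain ⟨g, hg, _, h⟩ := mem_sphere_succ.1 hf
    obtain ⟨g', hg', _, h'⟩ := mem_sphere_succ.1 hf'
    have hne : g ≠ g' := fun hgg => ih (fun i hi => hclean i (by omega)) hg (hgg ▸ hg')
    exact hclean (k + 1) le_rfl g (mem_sphere_of_child hc hce hg) g'
      (mem_ball.2 ⟨k + 1, le_rfl, mem_sphere_of_child hc' hce' hg'⟩) hne (h.symm.trans h')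

/-- Constraint node types of the steps down a tree for `h` half-iterations. -/
def stepType (h : ℕ) : ℕ → Bool := fun k => Nat.bodd (h + 1 + k)

/-- Passing to a child uses up one half-iteration and one step. The sum `h + 1 + k` has the parity
of `h - 1 - k`, without truncated subtraction. -/
theorem stepType_succ (h : ℕ) : (fun j => stepType (h + 1) (j + 1)) = stepType h := by
  funext j
  simp only [stepType]
  rw [show h + 1 + 1 + (j + 1) = (h + 1 + j) + 1 + 1 by ring]
  simp only [Nat.bodd_succ, Bool.not_not]

theorem stepType_succ_zero (h : ℕ) : stepType (h + 1) 0 = Nat.bodd h := by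
  simp [stepType, Nat.bodd_succ]

theorem stepType_alternates (h k : ℕ) : stepType h (k + 1) ≠ stepType h k := by
  simp only [stepType, ← add_assoc, Nat.bodd_succ]
  simp

/-- The neighbours of a variable node in half-iteration `h + 1`. -/
def graphChild (ρ : Bool → Equiv.Perm (Fin M × Fin n)) (h : ℕ) (e : Fin M × Fin n) (i : Fin n) :
    Fin M × Fin n :=
  (ρ (Nat.bodd h)).symm ((ρ (Nat.bodd h) e).1, i)

/-- The position of a variable node in its constraint node in half-iteration `h + 1`. -/
def graphPos (ρ : Bool → Equiv.Perm (Fin M × Fin n)) (h : ℕ) (e : Fin M × Fin n) : Fin n :=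
  (ρ (Nat.bodd h) e).2

theorem graphChild_fst (h : ℕ) (i : Fin n) :
    (ρ (Nat.bodd h) (graphChild ρ h e i)).1 = (ρ (Nat.bodd h) e).1 := by simp [graphChild]

theorem graphChild_snd (h : ℕ) (i : Fin n) :
    (ρ (Nat.bodd h) (graphChild ρ h e i)).2 = i := by simp [graphChild]

theorem graphChild_ne {h : ℕ} {i : Fin n} (hi : i ≠ graphPos ρ h e) : graphChild ρ h e i ≠ e := by
  intro heq
  apply hi
  rw [← graphChild_snd (ρ := ρ) (e := e) h i, heq, graphPos]

theorem exists_mem_sphere_of_mem_depSet {h : ℕ} {f : Fin M × Fin n}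
    (hf : f ∈ depSet (graphChild ρ) (graphPos ρ) h e) :
    ∃ k ≤ h, f ∈ sphere ρ (stepType h) k e := by
  induction h generalizing e with
  | zero => exact ⟨0, le_rfl, by simpa [depSet, sphere] using hf⟩
  | succ h ih =>
    simp only [depSet, Finset.mem_insert, Finset.mem_biUnion] at hf
    rcases hf with rfl | ⟨i, hi, hf⟩
    · exact ⟨0, by omega, mem_sphere_zero.2 rfl⟩
    · obtain ⟨k, hk, hfk⟩ := ih hf
      rw [← stepType_succ] at hfk
      refine ⟨k + 1, by omega, mem_sphere_of_child (graphChild_ne (Finset.ne_of_mem_erase hi)) ?_ hfk⟩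
      rw [stepType_succ_zero, graphChild_fst]

/-- A return to the root, or a meeting of branches at different depths, puts a node in two spheres
(`notMem_sphere_of_lt`); a meeting at equal depth is excluded by `notMem_sphere_sibling`. -/
theorem treeLike_of_clean {h : ℕ} (hclean : ∀ k < h, Clean ρ (stepType h) k e) :
    TreeLike (graphChild ρ) (graphPos ρ) h e := by
  induction h generalizing e with
  | zero => trivial
  | succ h ih =>
    have hfst : ∀ i, (ρ (stepType (h + 1) 0) (graphChild ρ h e i)).1 =
        (ρ (stepType (h + 1) 0) e).1 := fun i => by rw [stepType_succ_zero, graphChild_fst]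
    refine ⟨fun i hi => ⟨ih fun k hk => ?_, fun he => ?_⟩, fun i hi j hj hij =>
      Finset.disjoint_left.2 fun f hf hf' => ?_⟩
    · rw [← stepType_succ]
      exact (hclean (k + 1) (by omega)).child (graphChild_ne hi) (hfst i)
    · obtain ⟨k, hk, hek⟩ := exists_mem_sphere_of_mem_depSet he
      rw [← stepType_succ] at hek
      exact notMem_sphere_of_lt (j := 0) (fun i hi => hclean i (by omega)) (by omega)
        (mem_sphere_of_child (graphChild_ne hi) (hfst i) hek) (mem_sphere_zero.2 rfl)
    · obtain ⟨k, hk, hfk⟩ := exists_mem_sphere_of_mem_depSet hf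
      obtain ⟨k', hk', hfk'⟩ := exists_mem_sphere_of_mem_depSet hf'
      rw [← stepType_succ] at hfk hfk'
      have h1 := mem_sphere_of_child (graphChild_ne hi) (hfst i) hfk
      have h2 := mem_sphere_of_child (graphChild_ne hj) (hfst j) hfk'
      rcases lt_trichotomy k k' with hlt | rfl | hlt
      · exact notMem_sphere_of_lt (fun i hi => hclean i (by omega)) (by omega) h2 h1
      · refine notMem_sphere_sibling (graphChild_ne hi) (hfst i) (graphChild_ne hj) (hfst j) ?_
          (fun i hi => hclean i (by omega)) hfk hfk'
        intro heq
        apply hij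
        rw [← graphChild_snd (ρ := ρ) (e := e) h i, heq, graphChild_snd]
      · exact notMem_sphere_of_lt (fun i hi => hclean i (by omega)) (by omega) h1 h2

/-! ### Switching -/

/-- Exchange the sockets of type `s` of the variable nodes `f` and `x`. -/
def switch (ρ : Bool → Equiv.Perm (Fin M × Fin n)) (s : Bool) (f x : Fin M × Fin n) :
    Bool → Equiv.Perm (Fin M × Fin n) :=
  Function.update ρ s (ρ s * Equiv.swap f x)

theorem switch_same (s : Bool) (f x y : Fin M × Fin n) :
    switch ρ s f x s y = ρ s (Equiv.swap f x y) := by simp [switch]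

theorem switch_of_ne {s s' : Bool} (h : s' ≠ s) (f x : Fin M × Fin n) :
    switch ρ s f x s' = ρ s' := by simp [switch, h]

theorem switch_switch (s : Bool) (f x : Fin M × Fin n) :
    switch (switch ρ s f x) s f x = ρ := by
  simp [switch, mul_assoc]

/-- The steps that reach distance `k` never use the two exchanged sockets: `f` first appears at
distance `k`, and `x` does not appear at all. -/
theorem sphere_switch (hT : ∀ k, T (k + 1) ≠ T k) {k : ℕ} (hclean : ∀ i < k, Clean ρ T i e)
    {f x : Fin M × Fin n} (hf : f ∈ sphere ρ T k e) (hx : x ∉ ball ρ T k e) {j : ℕ} (hj : j ≤ k) :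
    sphere (switch ρ (T k) f x) T j e = sphere ρ T j e := by
  induction j with
  | zero => rfl
  | succ j ih =>
    have hxs : ∀ i ≤ k, x ∉ sphere ρ T i e := fun i hi h => hx (mem_ball.2 ⟨i, hi, h⟩)
    ext y
    rw [mem_sphere_succ, mem_sphere_succ, ih (by omega)]
    by_cases hs : T j = T k
    · have hjk : j + 1 < k := by
        rcases Nat.lt_or_ge (j + 1) k with h | h
        · exact h
        · exact absurd hs.symm (by rw [show k = j + 1 by omega]; exact hT j)
      have hfs : ∀ i < k, f ∉ sphere ρ T i e := fun i hi => notMem_sphere_of_lt hclean hi hf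
      have hg : ∀ g ∈ sphere ρ T j e, switch ρ (T k) f x (T j) g = ρ (T j) g := by
        intro g hg
        rw [hs, switch_same, Equiv.swap_apply_of_ne_of_ne]
        · rintro rfl; exact hfs j (by omega) hg
        · rintro rfl; exact hxs j (by omega) hg
      have hne : ∀ g ∈ sphere ρ T j e, f ≠ g ∧ x ≠ g := by
        intro g hg
        refine ⟨?_, ?_⟩ <;> rintro rfl
        · exact hfs j (by omega) hg
        · exact hxs j (by omega) hg
      have hf1 : ∀ g ∈ sphere ρ T j e, (ρ (T j) f).1 ≠ (ρ (T j) g).1 := fun g hg h =>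
        hfs (j + 1) hjk (mem_sphere_succ.2 ⟨g, hg, (hne g hg).1, h⟩)
      have hx1 : ∀ g ∈ sphere ρ T j e, (ρ (T j) x).1 ≠ (ρ (T j) g).1 := fun g hg h =>
        hxs (j + 1) (by omega) (mem_sphere_succ.2 ⟨g, hg, (hne g hg).2, h⟩)
      refine exists_congr fun g => and_congr_right fun hgm => and_congr_right fun _ => ?_
      rw [hg g hgm]
      have hsw : switch ρ (T k) f x (T j) y = ρ (T j) (Equiv.swap f x y) := by
        rw [hs, switch_same]
      rw [hsw]
      by_cases hyf : y = f
      · subst hyf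
        rw [Equiv.swap_apply_left]
        exact iff_of_false (hx1 g hgm) (hf1 g hgm)
      · by_cases hyx : y = x
        · subst hyx
          rw [Equiv.swap_apply_right]
          exact iff_of_false (hf1 g hgm) (hx1 g hgm)
        · rw [Equiv.swap_apply_of_ne_of_ne hyf hyx]
    · rw [switch_of_ne hs]

/-- Configurations with a first collision at distance `k` from `e`, together with the two nodes that
collide. -/
def collisions (M n : ℕ) (T : ℕ → Bool) (k : ℕ) (e : Fin M × Fin n) :
    Finset (Σ _ : Bool → Equiv.Perm (Fin M × Fin n), (Fin M × Fin n) × (Fin M × Fin n)) :=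
  Finset.univ.filter fun q => (∀ i < k, Clean q.1 T i e) ∧ q.2.1 ∈ sphere q.1 T k e ∧
    q.2.2 ∈ ball q.1 T k e ∧ q.2.1 ≠ q.2.2 ∧ (q.1 (T k) q.2.1).1 = (q.1 (T k) q.2.2).1

/-- Double counting by switching: a collision of `f` and `g`, with any `x` outside the ball, is sent
to the graph with `f` and `x` exchanged. There `x` shares a constraint node with `g`, leaving `n`
choices. The ball is unchanged and switching is an involution, so the map is injective. -/
theorem card_collisions_mul_le (hT : ∀ k, T (k + 1) ≠ T k) (k : ℕ) (e : Fin M × Fin n) :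
    (collisions M n T k e).card * (M * n - ballBound n k) ≤
      Fintype.card (Bool → Equiv.Perm (Fin M × Fin n)) * (ballBound n k * ballBound n k * n) := by
  let Y : Finset (Σ _ : (Σ _ : Bool → Equiv.Perm (Fin M × Fin n),
      (Fin M × Fin n) × (Fin M × Fin n)), Fin M × Fin n) :=
    (collisions M n T k e).sigma fun q => (ball q.1 T k e)ᶜ
  let W : Finset (Σ _ : (Σ _ : Bool → Equiv.Perm (Fin M × Fin n),
      (Fin M × Fin n) × (Fin M × Fin n)), Fin M × Fin n) :=
    (Finset.univ.sigma fun ρ => ball ρ T k e ×ˢ ball ρ T k e).sigma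
      fun q => Finset.univ.filter fun x => (q.1 (T k) x).1 = (q.1 (T k) q.2.2).1
  have hY : (collisions M n T k e).card * (M * n - ballBound n k) ≤ Y.card := by
    rw [Finset.card_sigma, ← smul_eq_mul]
    refine Finset.card_nsmul_le_sum _ _ _ fun q _ => ?_
    rw [Finset.card_compl, Fintype.card_prod, Fintype.card_fin, Fintype.card_fin]
    exact Nat.sub_le_sub_left (card_ball_le k) _
  have hW : W.card ≤ Fintype.card (Bool → Equiv.Perm (Fin M × Fin n)) *
      (ballBound n k * ballBound n k * n) := by
    rw [Finset.card_sigma]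
    simp only [card_filter_fst_eq, Finset.sum_const, smul_eq_mul]
    rw [Finset.card_sigma, ← mul_assoc]
    refine Nat.mul_le_mul_right _ ?_
    rw [← Finset.card_univ, ← smul_eq_mul]
    refine Finset.sum_le_card_nsmul _ _ _ fun ρ _ => ?_
    rw [Finset.card_product]
    exact Nat.mul_le_mul (card_ball_le k) (card_ball_le k)
  refine hY.trans (le_trans ?_ hW)
  refine Finset.card_le_card_of_injOn
    (fun q => ⟨⟨switch q.1.1 (T k) q.1.2.1 q.2, q.1.2⟩, q.2⟩) ?_ ?_
  · rintro ⟨⟨ρ, f, g⟩, x⟩ hq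
    simp only [Y, Finset.coe_sigma, Set.mem_sigma_iff, Finset.mem_coe, collisions,
      Finset.mem_filter, Finset.mem_univ, true_and, Finset.mem_compl] at hq
    obtain ⟨⟨hclean, hf, hg, hne, heq⟩, hx⟩ := hq
    have hsph := fun j (hj : j ≤ k) => sphere_switch hT hclean hf hx hj
    have hball : ball (switch ρ (T k) f x) T k e = ball ρ T k e := by
      ext y
      rw [mem_ball, mem_ball]
      exact exists_congr fun j => and_congr_right fun hj => by rw [hsph j hj]
    simp only [W, Finset.coe_sigma, Set.mem_sigma_iff, Finset.mem_coe, Finset.mem_filter,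
      Finset.mem_univ, true_and, Finset.mem_product, hball, switch_same]
    refine ⟨⟨mem_ball.2 ⟨k, le_rfl, hf⟩, hg⟩, ?_⟩
    rw [Equiv.swap_apply_right, Equiv.swap_apply_of_ne_of_ne hne.symm, heq]
    rintro rfl
    exact hx hg
  · rintro ⟨⟨ρ, f, g⟩, x⟩ _ ⟨⟨ρ', f', g'⟩, x'⟩ _ h
    simp only [Sigma.mk.injEq, heq_eq_eq, Prod.mk.injEq] at h
    obtain ⟨⟨h1, rfl, rfl⟩, rfl⟩ := h
    have : ρ = ρ' := by
      rw [← switch_switch (ρ := ρ) (T k) f x, h1, switch_switch]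
    rw [this]

/-- The least radius that is not clean supplies a witness in `collisions`, whose definition demands
cleanness below it. -/
theorem card_not_clean_le (h : ℕ) (e : Fin M × Fin n) :
    (Finset.univ.filter fun ρ : Bool → Equiv.Perm (Fin M × Fin n) =>
      ¬ ∀ k < h, Clean ρ T k e).card ≤ ∑ k ∈ Finset.range h, (collisions M n T k e).card := by
  refine le_trans (Finset.card_le_card (t := (Finset.range h).biUnion fun k =>
    (collisions M n T k e).image Sigma.fst) ?_) (Finset.card_biUnion_le.trans
      (Finset.sum_le_sum fun k _ => Finset.card_image_le))
  intro ρ hρ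
  simp only [Finset.mem_filter, Finset.mem_univ, true_and, not_forall] at hρ
  obtain ⟨k, hk, hbad⟩ := hρ
  obtain ⟨m, hm, hmin, hmk⟩ : ∃ m, ¬ Clean ρ T m e ∧ (∀ i < m, Clean ρ T i e) ∧ m ≤ k := by
    have hex : ∃ k, ¬ Clean ρ T k e := ⟨k, hbad⟩
    exact ⟨Nat.find hex, Nat.find_spec hex, fun i hi => not_not.1 (Nat.find_min hex hi),
      Nat.find_min' hex hbad⟩
  unfold Clean at hm
  push Not at hm
  obtain ⟨f, hf, g, hg, hne, heq⟩ := hm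
  refine Finset.mem_biUnion.2 ⟨m, Finset.mem_range.2 (by omega), ?_⟩
  refine Finset.mem_image.2 ⟨⟨ρ, f, g⟩, ?_, rfl⟩
  simp only [collisions, Finset.mem_filter, Finset.mem_univ, true_and]
  exact ⟨hmin, hf, hg, hne, heq⟩

/-! ### Relabelling -/

theorem mem_sphere_relabel (τ : Equiv.Perm (Fin M × Fin n)) {k : ℕ} {f : Fin M × Fin n} :
    f ∈ sphere (fun s => ρ s * τ) T k e ↔ τ f ∈ sphere ρ T k (τ e) := by
  induction k generalizing f with
  | zero => simp [mem_sphere_zero]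
  | succ k ih =>
    rw [mem_sphere_succ, mem_sphere_succ]
    constructor
    · rintro ⟨g, hg, hne, h⟩
      exact ⟨τ g, ih.1 hg, fun h => hne (τ.injective h), h⟩
    · rintro ⟨g, hg, hne, h⟩
      refine ⟨τ.symm g, ih.2 (by simpa using hg), fun h => hne (by simp [h]), ?_⟩
      simpa using h

theorem clean_relabel (τ : Equiv.Perm (Fin M × Fin n)) {k : ℕ} :
    Clean (fun s => ρ s * τ) T k e ↔ Clean ρ T k (τ e) := by
  have hb : ∀ f, f ∈ ball (fun s => ρ s * τ) T k e ↔ τ f ∈ ball ρ T k (τ e) := by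
    intro f
    rw [mem_ball, mem_ball]
    simp only [mem_sphere_relabel]
  unfold Clean
  constructor
  · intro h f hf g hg hne
    have := h (τ.symm f) (mem_sphere_relabel τ |>.2 (by simpa using hf)) (τ.symm g)
      ((hb _).2 (by simpa using hg)) (by simpa using hne)
    simpa using this
  · intro h f hf g hg hne
    exact h (τ f) ((mem_sphere_relabel τ).1 hf) (τ g) ((hb g).1 hg) (by simpa using hne)

/-- The two partitions of the ensemble member given by `π`. -/
def edgePerms (π : Equiv.Perm (Fin M × Fin n)) : Bool → Equiv.Perm (Fin M × Fin n) :=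
  fun s => if s then π else 1

/-- Relabelling by `τ` sends the pair `(1, π)` to `(τ, π * τ)` and the node `e` to `τ.symm e`. All
three data can be recovered, so bad ensemble members inject into bad pairs of permutations with a
root. -/
theorem card_not_clean_edgePerms_mul_le (h : ℕ) :
    (Finset.univ.filter fun q : Equiv.Perm (Fin M × Fin n) × (Fin M × Fin n) =>
      ¬ ∀ k < h, Clean (edgePerms q.1) T k q.2).card *
        Fintype.card (Equiv.Perm (Fin M × Fin n)) ≤
    ∑ e : Fin M × Fin n, (Finset.univ.filter fun ρ : Bool → Equiv.Perm (Fin M × Fin n) =>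
      ¬ ∀ k < h, Clean ρ T k e).card := by
  rw [← Finset.card_univ, ← Finset.card_product, ← Finset.card_sigma]
  refine Finset.card_le_card_of_injOn
    (fun q => ⟨q.2.symm q.1.2, fun s => edgePerms q.1.1 s * q.2⟩) ?_ ?_
  · rintro ⟨⟨π, e⟩, τ⟩ hq
    simp only [Finset.coe_product, Set.mem_prod, Finset.mem_coe, Finset.mem_filter,
      Finset.mem_univ, true_and, and_true, Finset.coe_sigma, Set.mem_sigma_iff, clean_relabel,
      Equiv.apply_symm_apply] at hq ⊢
    exact hq
  · rintro ⟨⟨π, e⟩, τ⟩ _ ⟨⟨π', e'⟩, τ'⟩ _ hq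
    simp only [Sigma.mk.injEq, heq_eq_eq] at hq
    obtain ⟨h1, h2⟩ := hq
    have hτ : τ = τ' := by simpa [edgePerms] using congrFun h2 false
    subst hτ
    have hπ : π = π' := by simpa [edgePerms] using congrFun h2 true
    have he : e = e' := τ.symm.injective h1
    rw [hπ, he]

end Graph

/-! ## Concentration of the ensemble on the computation tree -/

section Ensemble

open Classical

theorem ensMsg_eq_genMsg {M : ℕ} (C : LinCode n) (t : ℕ) (π : Equiv.Perm (Fin M × Fin n))
    (μ : ℕ → Lut) (l : Fin M × Fin n → ℝ) (h : ℕ) (e : Fin M × Fin n) :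
    ensMsg C t π μ l h e =
      genMsg C t (graphChild (edgePerms π)) (graphPos (edgePerms π)) μ l h e := by
  induction h generalizing e with
  | zero => rfl
  | succ h ih =>
    have hb : Nat.bodd h = if Even h then false else true := by
      rcases Nat.even_or_odd h with hh | hh
      · simp [hh, Nat.even_iff.1 hh, Nat.bodd_eq_one_and_ne_zero]
      · simp [Nat.not_even_iff_odd.2 hh, Nat.odd_iff.1 hh, Nat.bodd_eq_one_and_ne_zero]
    rw [ensMsg, genMsg]
    simp only [ih, graphChild, graphPos, hb]
    split_ifs
    · simp only [edgePerms, Bool.false_eq_true, if_false]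
      rfl
    · simp only [edgePerms, if_true]

theorem mem_code_of_mem_gldpcCode {M : ℕ} {C : LinCode n} {π : Equiv.Perm (Fin M × Fin n)}
    {w : Fin M × Fin n → ZMod 2} (hw : w ∈ gldpcCode C π) (h : ℕ) (e : Fin M × Fin n) :
    (fun i => if i = graphPos (edgePerms π) h e then w e
      else w (graphChild (edgePerms π) h e i)) ∈ C := by
  have : (fun i => if i = graphPos (edgePerms π) h e then w e
      else w (graphChild (edgePerms π) h e i)) =
      fun i => w (graphChild (edgePerms π) h e i) := by
    ext i
    split_ifs with hi
    · rw [hi]; simp [graphChild, graphPos]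
    · rfl
  rw [this]
  unfold graphChild edgePerms
  cases Nat.bodd h
  · exact hw.1 e.1
  · exact hw.2 (π e).1

/-- Bound on the probability that the neighbourhood of depth `h` is not tree-like. -/
def cycleBound (n h M : ℕ) : ℝ :=
  ∑ k ∈ Finset.range h, (ballBound n k * ballBound n k * n : ℝ) / ((M : ℝ) * n - ballBound n k)

theorem tendsto_cycleBound (hn : 0 < n) (h : ℕ) :
    Tendsto (cycleBound n h) atTop (𝓝 0) := by
  rw [show (0 : ℝ) = ∑ k ∈ Finset.range h, 0 by simp]
  refine tendsto_finsetSum _ fun k _ => ?_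
  refine tendsto_const_nhds.div_atTop ?_
  refine tendsto_atTop_add_const_right _ _ ?_
  exact tendsto_natCast_atTop_atTop.atTop_mul_const (by exact_mod_cast hn)

/-- There are `tot * tot` pairs of permutations; one factor `tot` is the cost of relabelling and
cancels. The size hypothesis makes the denominators of `cycleBound` positive. -/
theorem card_not_treeLike_le {M h : ℕ} (hM : ∀ k < h, ballBound n k < M * n) :
    ((Finset.univ.filter fun q : Equiv.Perm (Fin M × Fin n) × (Fin M × Fin n) =>
      ¬ TreeLike (graphChild (edgePerms q.1)) (graphPos (edgePerms q.1)) h q.2).card : ℝ) ≤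
    cycleBound n h M *
      (Fintype.card (Equiv.Perm (Fin M × Fin n)) * Fintype.card (Fin M × Fin n)) := by
  set tot := Fintype.card (Equiv.Perm (Fin M × Fin n)) with htot
  have htot0 : (0 : ℝ) < tot := by exact_mod_cast Fintype.card_pos
  have h1 : (Finset.univ.filter fun q : Equiv.Perm (Fin M × Fin n) × (Fin M × Fin n) =>
      ¬ TreeLike (graphChild (edgePerms q.1)) (graphPos (edgePerms q.1)) h q.2).card ≤
      (Finset.univ.filter fun q : Equiv.Perm (Fin M × Fin n) × (Fin M × Fin n) =>
      ¬ ∀ k < h, Clean (edgePerms q.1) (stepType h) k q.2).card :=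
    Finset.card_le_card (Finset.monotone_filter_right _
      fun q _ hq hc => hq (treeLike_of_clean hc))
  have h2 := card_not_clean_edgePerms_mul_le (M := M) (n := n) (T := stepType h) h
  have h3 : ∀ e : Fin M × Fin n, ∀ k ∈ Finset.range h,
      ((collisions M n (stepType h) k e).card : ℝ) ≤
      (ballBound n k * ballBound n k * n : ℝ) / ((M : ℝ) * n - ballBound n k) * (tot * tot) := by
    intro e k hk
    have hlt := hM k (Finset.mem_range.1 hk)
    have hpos : (0 : ℝ) < (M : ℝ) * n - ballBound n k := by
      rw [sub_pos]; exact_mod_cast hlt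
    have := card_collisions_mul_le (stepType_alternates h) k e
    have : (((collisions M n (stepType h) k e).card * (M * n - ballBound n k) : ℕ) : ℝ) ≤
        ((Fintype.card (Bool → Equiv.Perm (Fin M × Fin n)) *
          (ballBound n k * ballBound n k * n) : ℕ) : ℝ) := by exact_mod_cast this
    rw [Fintype.card_fun, Fintype.card_bool, ← htot] at this
    push_cast [Nat.cast_sub hlt.le] at this
    rw [div_mul_eq_mul_div, le_div_iff₀ hpos]
    linarith
  have h4 : (((Finset.univ.filter fun q : Equiv.Perm (Fin M × Fin n) × (Fin M × Fin n) =>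
      ¬ ∀ k < h, Clean (edgePerms q.1) (stepType h) k q.2).card * tot : ℕ) : ℝ) ≤
      ((∑ e : Fin M × Fin n, ∑ k ∈ Finset.range h, (collisions M n (stepType h) k e).card : ℕ) : ℝ) := by
    exact_mod_cast h2.trans (Finset.sum_le_sum fun e _ => card_not_clean_le h e)
  have h5 : ((∑ e : Fin M × Fin n, ∑ k ∈ Finset.range h,
      (collisions M n (stepType h) k e).card : ℕ) : ℝ) ≤
      Fintype.card (Fin M × Fin n) * (cycleBound n h M * (tot * tot)) := by
    push_cast
    refine (Finset.sum_le_sum fun e _ => Finset.sum_le_sum (h3 e)).trans ?_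
    rw [Finset.sum_const, ← Finset.sum_mul, Finset.card_univ, nsmul_eq_mul]
    rfl
  refine le_trans (Nat.cast_le.2 h1) ?_
  have h6 := h4.trans h5
  rw [Nat.cast_mul] at h6
  refine le_of_mul_le_mul_right (h6.trans_eq ?_) htot0
  ring

/-- Tree-like pairs of a graph and a node contribute exactly `x`, whichever codeword is sent. The
others are off by at most `1`, so the total deviation is at most `cycleBound`. -/
theorem tendsto_ensErr {C : LinCode n} {t : ℕ} (hC : CorrectsErrors C t)
    (hCt : HasTransitiveAut C) {σ : ℝ} (hσ : 0 < σ) (hn : 0 < n) {μ : ℕ → Lut} {h : ℕ}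
    (hμ : ∀ k ≤ h, OddLut (μ k))
    (w : (M : ℕ) → Equiv.Perm (Fin M × Fin n) → Fin M × Fin n → ZMod 2)
    (hw : ∀ M π, w M π ∈ gldpcCode C π) {x : ℝ} (hx : deSeq C t σ μ h = x) (hx0 : 0 ≤ x)
    (hx1 : x ≤ 1) :
    Tendsto (fun M => ensErr C t σ μ M (w M) h) atTop (𝓝 x) := by
  rw [tendsto_iff_norm_sub_tendsto_zero]
  refine squeeze_zero' (Eventually.of_forall fun M => norm_nonneg _) ?_ (tendsto_cycleBound hn h)
  have hlarge : ∀ᶠ M : ℕ in atTop, ∀ k < h, ballBound n k < M * n := by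
    refine (Set.finite_lt_nat h).eventually_all.2 fun k _ => ?_
    filter_upwards [eventually_gt_atTop (ballBound n k)] with M hM
    exact hM.trans_le (Nat.le_mul_of_pos_right M hn)
  filter_upwards [hlarge, eventually_gt_atTop 0] with M hM hM0
  have hbad := card_not_treeLike_le hM
  set N : ℝ := Fintype.card (Equiv.Perm (Fin M × Fin n)) * Fintype.card (Fin M × Fin n) with hN
  have hNpos : 0 < N := by
    have h1 : 0 < Fintype.card (Fin M × Fin n) := by simp [hn, hM0]
    have h2 : 0 < Fintype.card (Equiv.Perm (Fin M × Fin n)) := Fintype.card_pos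
    positivity
  let q : Equiv.Perm (Fin M × Fin n) × (Fin M × Fin n) → ℝ := fun k =>
    (Measure.pi (fun _ : Fin M × Fin n => gaussianReal 0 (σ ^ 2).toNNReal)).real
      {z | ensMsg C t k.1 μ (fun e' => llr σ (w M k.1 e') (z e')) h k.2 ≠ w M k.1 k.2}
  have hens : ensErr C t σ μ M (w M) h = (∑ k, q k) / N := by
    rw [ensErr, Fintype.sum_prod_type]
  have hq : ∀ k, |q k - x| ≤ if ¬ TreeLike (graphChild (edgePerms k.1))
      (graphPos (edgePerms k.1)) h k.2 then 1 else 0 := by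
    rintro ⟨π, e⟩
    split_ifs with htree
    · have := measureReal_genMsg (P := Measure.pi (fun _ : Fin M × Fin n => noiseLaw σ))
        (z := fun v y => y v) (w := w M π) (μ := μ) hC hCt hσ (fun v => measurable_pi_apply v)
        (iIndepFun_pi (X := fun _ y => y) fun _ => aemeasurable_id)
        (fun v => (measurePreserving_eval (fun _ : Fin M × Fin n => noiseLaw σ) v).map_eq)
        (mem_code_of_mem_gldpcCode (hw M π)) h hμ e htree
      rw [hx] at this
      have hqx : q (π, e) = x := by
        rw [← this]
        simp only [q, ensMsg_eq_genMsg]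
        rfl
      simp [hqx]
    · have h0 : 0 ≤ q (π, e) := measureReal_nonneg
      have h1 : q (π, e) ≤ 1 := measureReal_le_one
      rw [abs_le]; constructor <;> linarith
  have hcard : (Fintype.card (Equiv.Perm (Fin M × Fin n) × (Fin M × Fin n)) : ℝ) = N := by
    rw [Fintype.card_prod]; push_cast; rfl
  have hdiff : ensErr C t σ μ M (w M) h - x = (∑ k, (q k - x)) / N := by
    rw [hens, Finset.sum_sub_distrib, Finset.sum_const, Finset.card_univ, nsmul_eq_mul, hcard,
      sub_div, mul_div_cancel_left₀ _ hNpos.ne']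
  rw [hdiff, norm_div, Real.norm_eq_abs, Real.norm_eq_abs, abs_of_pos hNpos, div_le_iff₀ hNpos]
  refine le_trans ?_ hbad
  refine (Finset.abs_sum_le_sum_abs _ _).trans ((Finset.sum_le_sum fun k _ => hq k).trans_eq ?_)
  rw [Finset.sum_boole]

end Ensemble

end

end IBDDCR

/-! ### The proposition: tables, conditional laws, recursion and ensemble limit -/

theorem proposition1 {n : ℕ} (C : LinCode n) (t : ℕ) (hC : CorrectsErrors C t)
    (hCt : HasTransitiveAut C) (σ : ℝ) (hσ : 0 < σ)
    {Ω : Type*} [MeasurableSpace Ω] (P : Measure Ω) [IsProbabilityMeasure P]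
    (pos : List (Fin n) → Fin n)
    -- the transmitted random codeword on the computation tree; both root bits have positive probability
    (c : Ω → List (Fin n) → ZMod 2) (hc : Measurable c)
    (hcode : ∀ ω, IsTreeCodeword C pos (c ω)) (hbit : ∀ b, P {ω | c ω [] = b} ≠ 0)
    -- the noise: independent, centred Gaussian of variance `σ²`, independent of the codeword
    (z : Ω → List (Fin n) → ℝ) (hz : Measurable z)
    (hlaw : ∀ v, HasLaw (fun ω => z ω v) (gaussianReal 0 (σ ^ 2).toNNReal) P)
    (hindep : iIndepFun (fun v ω => z ω v) P) (hcz : IndepFun c z P) :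
    let μ := muTilde P C t σ pos c z
    let xr := rowErr P C t σ pos c z
    let xc := colErr P C t σ pos c z
    -- the correction terms for row decoding in iteration `ℓ`
    (∀ ℓ ≥ 1, μ (2 * ℓ - 1) (-1) (-1) = Real.log (fPe C t (xc (ℓ - 1)) / fQc C t (xc (ℓ - 1))) ∧
      μ (2 * ℓ - 1) 1 (-1) = Real.log (fPc C t (xc (ℓ - 1)) / fQe C t (xc (ℓ - 1))) ∧
      μ (2 * ℓ - 1) 0 (-1) = Real.log (fPz C t (xc (ℓ - 1)) / fQz C t (xc (ℓ - 1))) ∧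
      μ (2 * ℓ - 1) (-1) 1 = Real.log (fQe C t (xc (ℓ - 1)) / fPc C t (xc (ℓ - 1))) ∧
      μ (2 * ℓ - 1) 1 1 = Real.log (fQc C t (xc (ℓ - 1)) / fPe C t (xc (ℓ - 1))) ∧
      μ (2 * ℓ - 1) 0 1 = Real.log (fQz C t (xc (ℓ - 1)) / fPz C t (xc (ℓ - 1)))) ∧
    -- the correction terms for column decoding in iteration `ℓ`
    (∀ ℓ ≥ 1, μ (2 * ℓ) (-1) (-1) = Real.log (fPe C t (xr ℓ) / fQc C t (xr ℓ)) ∧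
      μ (2 * ℓ) 1 (-1) = Real.log (fPc C t (xr ℓ) / fQe C t (xr ℓ)) ∧
      μ (2 * ℓ) 0 (-1) = Real.log (fPz C t (xr ℓ) / fQz C t (xr ℓ)) ∧
      μ (2 * ℓ) (-1) 1 = Real.log (fQe C t (xr ℓ) / fPc C t (xr ℓ)) ∧
      μ (2 * ℓ) 1 1 = Real.log (fQc C t (xr ℓ) / fPe C t (xr ℓ)) ∧
      μ (2 * ℓ) 0 1 = Real.log (fQz C t (xr ℓ) / fPz C t (xr ℓ))) ∧
    -- the conditional probabilities behind them: at input message error probability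
    -- `x = msgErr h`, for the BDD output of half-iteration `h + 1`
    (∀ h, let x := msgErr P C t σ pos c z h
      let p := condBdd P C t σ pos c z μ h
      (p (-1) (-1) 0 = fPe C t x ∧ p 1 (-1) 0 = fPc C t x ∧ p 0 (-1) 0 = fPz C t x ∧
        p (-1) 1 0 = fQe C t x ∧ p 1 1 0 = fQc C t x ∧ p 0 1 0 = fQz C t x) ∧
      (p 1 1 1 = fPe C t x ∧ p (-1) 1 1 = fPc C t x ∧ p 0 1 1 = fPz C t x ∧
        p 1 (-1) 1 = fQe C t x ∧ p (-1) (-1) 1 = fQc C t x ∧ p 0 (-1) 1 = fQz C t x)) ∧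
    (∀ i < n, Pz C t i = 1 - Pe C t i - Pc C t i ∧ Qz C t i = 1 - Qe C t i - Qc C t i) ∧
    -- the density evolution recursions
    xc 0 = gaussQ (1 / σ) ∧
    (∀ ℓ ≥ 1, xr ℓ = deStep C t σ (xc (ℓ - 1)) ∧ xc ℓ = deStep C t σ (xr ℓ)) ∧
    -- they give the limiting message error probabilities of iBDD-CR on the GLDPC ensemble
    (∀ w : (M : ℕ) → Equiv.Perm (Fin M × Fin n) → Fin M × Fin n → ZMod 2,
      (∀ M π, w M π ∈ gldpcCode C π) → ∀ ℓ ≥ 1,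
        Tendsto (fun M => ensErr C t σ μ M (w M) (2 * ℓ - 1)) atTop (𝓝 (xr ℓ)) ∧
        Tendsto (fun M => ensErr C t σ μ M (w M) (2 * ℓ)) atTop (𝓝 (xc ℓ))) := by
  intro μ xr xc
  have hlaw' : ∀ v, P.map (fun ω => z ω v) = noiseLaw σ := fun v => (hlaw v).map_eq
  have hodd : ∀ h, OddLut (μ h) := fun h =>
    oddLut_muTilde hC hCt hσ hc hcode hbit hz hlaw' hindep hcz h
  have herr : ∀ h, msgErr P C t σ pos c z h = deSeq C t σ μ h := fun h =>
    msgErr_eq_deSeq hC hCt hσ hc hcode hz hlaw' hindep hcz fun k _ => hodd k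
  have hopt : ∀ h, optLut C t (msgErr P C t σ pos c z h) (μ (h + 1)) := fun h => by
    rw [herr]
    exact optLut_muTilde_succ hC hCt hσ hc hcode hbit hz hlaw' hindep hcz fun k _ => hodd k
  have hstep : ∀ h, msgErr P C t σ pos c z (h + 1) =
      deStep C t σ (msgErr P C t σ pos c z h) := fun h => by
    rw [← oneStep_eq_deStep C t hσ (hopt h), herr, herr, deSeq]
  have hcond : ∀ h u r b, condBdd P C t σ pos c z μ h u (bitSign r) b =
      mix n (outcomeProb C t (r + b) (bitSign b * u)) (msgErr P C t σ pos c z h) :=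
    fun h u r b => by
      rw [herr]
      exact condBdd_eq_mix hC hCt hσ hc hcode hbit hz hlaw' hindep hcz (fun k _ => hodd k) u r b
  have hlim : ∀ w : (M : ℕ) → Equiv.Perm (Fin M × Fin n) → Fin M × Fin n → ZMod 2,
      (∀ M π, w M π ∈ gldpcCode C π) → ∀ h,
        Tendsto (fun M => ensErr C t σ μ M (w M) h) atTop (𝓝 (msgErr P C t σ pos c z h)) :=
    -- Positivity of `n` comes from `pos []`, an element of `Fin n`.
    fun w hw h => tendsto_ensErr hC hCt hσ (pos []).pos (fun k _ => hodd k) w hw (herr h).symm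
      measureReal_nonneg measureReal_le_one
  have hodd_idx : ∀ ℓ ≥ 1, 2 * ℓ - 1 = 2 * (ℓ - 1) + 1 := fun ℓ hℓ => by omega
  have heven_idx : ∀ ℓ ≥ 1, 2 * ℓ = (2 * ℓ - 1) + 1 := fun ℓ hℓ => by omega
  refine ⟨fun ℓ hℓ => ?_, fun ℓ hℓ => ?_, fun h => ⟨?_, ?_⟩, fun i hi => ⟨?_, ?_⟩, ?_,
    fun ℓ hℓ => ⟨?_, ?_⟩, fun w hw ℓ _ => ⟨hlim w hw _, hlim w hw _⟩⟩
  · rw [hodd_idx ℓ hℓ]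
    exact hopt (2 * (ℓ - 1))
  · have := hopt (2 * ℓ - 1)
    rwa [← heven_idx ℓ hℓ] at this
  -- The arguments after `h` are the BDD output, the hard bit (`1` for sign `-1`) and the root bit.
  · exact ⟨hcond h (-1) 1 0, hcond h 1 1 0, hcond h 0 1 0, hcond h (-1) 0 0, hcond h 1 0 0,
      hcond h 0 0 0⟩
  · exact ⟨hcond h 1 0 1, hcond h (-1) 0 1, hcond h 0 0 1, hcond h 1 1 1, hcond h (-1) 1 1,
      hcond h 0 1 1⟩
  · have := outcomeProb_zero_eq (C := C) t 1 hi
    exact this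
  · have := outcomeProb_zero_eq (C := C) t 0 hi
    exact this.trans (by unfold Qe Qc; rfl)
  · exact herr 0
  · change msgErr P C t σ pos c z (2 * ℓ - 1) = _
    rw [hodd_idx ℓ hℓ]
    exact hstep _
  · have := hstep (2 * ℓ - 1)
    rwa [← heven_idx ℓ hℓ] at this
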